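/- Let $(W,S)$ be a Coxeter system with length function $\ell$ and Bruhat–Chevalley order $\le$, and let $\{p_s\}_{s\in S}\subseteq\mathbb{Z}$ be weights such that $p_s>0$ for all $s\in S$ and $p_s=p_t$ whenever $s,t\in S$ are conjugate in $W$. Let $A=\mathbb{Z}[v,v^{-1}]$ and let $\mathcal{H}$ be the generic Iwahori–Hecke algebra over $A$, that is, the associative $A$-algebra with $A$-basis $\{T_w\mid w\in W\}$, unit $T_1$, and multiplication determined, for $s\in S$ and $w\in W$, by $T_sT_w=T_{sw}$ if $sw>w$ and $T_sT_w=T_{sw}+(v^{p_s}-v^{-p_s})T_w$ if $sw<w$. Let $h\mapsto\overline{h}$ be the ring involution of $\mathcal{H}$ with $\overline{v}=v^{-1}$ and $\overline{T_w}=T_{w^{-1}}^{-1}$, and let $\{C'_w\mid w\in W\}$ be the Kazhdan–Lusztig basis of $\mathcal{H}$: $C'_w$ is the unique element such that $\overline{C'_w}=C'_w$ and $C'_w-T_w\in\bigoplus_{y\in W}v^{-1}\mathbb{Z}[v^{-1}]\,T_y$. Write $x\leftarrow_L y$ if, for some $s\in S$, the element $C'_x$ occurs with non-zero coefficient in the expansion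 of $C'_sC'_y$ in the basis $\{C'_z\}$. Let $\le_L$ be the reflexive and transitive closure of $\leftarrow_L$, and write $x\sim_L y$ if $x\le_L y$ and $y\le_L x$; the equivalence classes of $\sim_L$ are the left cells of $W$. For $w\in W$ let $\mathcal{R}(w)=\{s\in S\mid ws<w\}$ and $$\mathcal{R}^\pi(w)=\mathcal{R}(w)\cup\{sts\mid s,t\in S,\ st\neq ts,\ p_s<p_t,\ wsts<w\}.$$ (a) For all $x,y\in W$: if $x\sim_L y$, then $\mathcal{R}^\pi(x)=\mathcal{R}^\pi(y)$. (b) If $S$ has exactly two elements (so that $W$ is a finite or infinite dihedral group), then for all $x,y\in W$: $x\sim_L y$ if and only if $\mathcal{R}^\pi(x)=\mathcal{R}^\pi(y)$. -/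

import Mathlib

/-!
Weight functions on Coxeter groups, the generic Iwahori-Hecke algebra with its standard basis,
the Kazhdan-Lusztig basis, the left pre-order, left cells, and the enhanced right descent set.
-/

open scoped LaurentPolynomial

noncomputable section

namespace KLCell

open CoxeterSystem

variable {B W : Type*} [Group W] {M : CoxeterMatrix B} (cs : CoxeterSystem M W)

/-- Integral weights `p_s` of the simple reflections, equal on conjugate simple reflections. -/
structure Weights where
  /-- The weight of the simple reflection with the given index. -/
  wt : B → ℤ
  wt_eq_of_isConj : ∀ i j, IsConj (cs.simple i) (cs.simple j) → wt i = wt j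

/-- The Bruhat-Chevalley order `u < w`: there is a chain of multiplications by reflections from
`u` to `w` in which the length increases at every step. -/
def BruhatLT (u w : W) : Prop :=
  Relation.TransGen (fun a b ↦ ∃ t, cs.IsReflection t ∧ b = a * t ∧ cs.length a < cs.length b) u w

/-- For a reflection `t`, the relation `wt < w` is read off from the lengths. -/
lemma bruhatLT_mul_reflection_iff {w t : W} (ht : cs.IsReflection t) :
    BruhatLT cs (w * t) w ↔ cs.length (w * t) < cs.length w := by
  constructor
  · intro h
    unfold BruhatLT at h
    generalize w * t = u at h
    induction h with
    | single h => obtain ⟨_, _, _, h⟩ := h; exact h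
    | tail _ h ih => obtain ⟨_, _, _, h⟩ := h; exact ih.trans h
  · intro h
    exact .single ⟨t, ht, by rw [mul_assoc, ht.mul_self, mul_one], h⟩

section Exchange

/-! ### The exchange property, in the form needed for the associativity of the Hecke algebra -/

open Classical in
/-- The action of a simple reflection on pairs (group element, sign). -/
def signAct (i : B) : Function.End (W × ZMod 2) := fun a ↦
  (cs.simple i * a.1 * cs.simple i, a.2 + if a.1 = cs.simple i then 1 else 0)

open Classical in
lemma signAct_mul_pow (i j : B) (k : ℕ) (x : W) (z : ZMod 2) :
    ((signAct cs i * signAct cs j) ^ k : Function.End (W × ZMod 2)) (x, z) =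
      ((cs.simple i * cs.simple j) ^ k * x * (cs.simple j * cs.simple i) ^ k,
        z + ∑ l ∈ Finset.range (2 * k),
          if x = (cs.simple j * cs.simple i) ^ l * cs.simple j then 1 else 0) := by
  have hcomm : ∀ l : ℕ, (cs.simple j * cs.simple i) ^ l * cs.simple j =
      cs.simple j * (cs.simple i * cs.simple j) ^ l := by
    intro l
    induction l with
    | zero => simp
    | succ l ih => rw [pow_succ', mul_assoc, ih, pow_succ']; simp only [mul_assoc]
  have hinv : ∀ l : ℕ, (cs.simple i * cs.simple j) ^ l = ((cs.simple j * cs.simple i) ^ l)⁻¹ := by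
    intro l
    rw [← inv_pow]; simp
  induction k with
  | zero => simp; rfl
  | succ k ih =>
    rw [pow_succ']
    have key : ∀ y z', signAct cs i (signAct cs j (y, z')) =
        (cs.simple i * (cs.simple j * y * cs.simple j) * cs.simple i,
          z' + (if y = cs.simple j then 1 else 0) +
            if cs.simple j * y * cs.simple j = cs.simple i then 1 else 0) := fun _ _ ↦ rfl
    refine (congrArg (fun a ↦ signAct cs i (signAct cs j a)) ih).trans ((key _ _).trans ?_)
    rw [show 2 * (k + 1) = 2 * k + 1 + 1 by ring, Finset.sum_range_succ, Finset.sum_range_succ]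
    have h1 : ((cs.simple i * cs.simple j) ^ k * x * (cs.simple j * cs.simple i) ^ k =
        cs.simple j) ↔ x = (cs.simple j * cs.simple i) ^ (2 * k) * cs.simple j := by
      rw [two_mul, pow_add, mul_assoc _ _ (cs.simple j), hcomm k, hinv, mul_assoc,
        inv_mul_eq_iff_eq_mul, ← eq_mul_inv_iff_mul_eq, ← mul_assoc]
    have h2 : (cs.simple j * ((cs.simple i * cs.simple j) ^ k * x *
        (cs.simple j * cs.simple i) ^ k) * cs.simple j = cs.simple i) ↔
        x = (cs.simple j * cs.simple i) ^ (2 * k + 1) * cs.simple j := by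
      have e : (cs.simple j * cs.simple i) ^ (2 * k + 1) * cs.simple j =
          (cs.simple j * cs.simple i) ^ k * (cs.simple j * cs.simple i * cs.simple j) *
            (cs.simple i * cs.simple j) ^ k := by
        have e1 : (cs.simple j * cs.simple i) ^ (2 * k + 1) = (cs.simple j * cs.simple i) ^ k *
            ((cs.simple j * cs.simple i) * (cs.simple j * cs.simple i) ^ k) := by
          rw [← pow_succ', ← pow_add]; congr 1; omega
        rw [e1, mul_assoc _ _ (cs.simple j), mul_assoc _ _ (cs.simple j), hcomm k]
        simp only [mul_assoc]
      rw [e, hinv, eq_mul_inv_iff_mul_eq, ← inv_mul_eq_iff_eq_mul, mul_assoc,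
        ← mul_right_inj (cs.simple j), ← mul_left_inj (cs.simple j)]
      simp [mul_assoc]
    refine Prod.ext ?_ ?_
    · simp only [pow_succ' (cs.simple i * cs.simple j), pow_succ (cs.simple j * cs.simple i),
        mul_assoc]
    · simp only [h1, h2, add_assoc]

lemma isLiftable_signAct : M.IsLiftable (signAct cs) := by
  classical
  intro i j
  funext a
  obtain ⟨x, z⟩ := a
  have h0 : (cs.simple j * cs.simple i) ^ M i j = 1 := by
    rw [M.symmetric]; exact cs.simple_mul_simple_pow j i
  rw [signAct_mul_pow, cs.simple_mul_simple_pow, h0, two_mul, Finset.sum_range_add]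
  simp only [pow_add, h0, one_mul, mul_one]
  rw [CharTwo.add_self_eq_zero, add_zero]
  rfl

open Classical in
lemma lift_signAct_wordProd (ω : List B) (x : W) (z : ZMod 2) :
    cs.lift ⟨signAct cs, isLiftable_signAct cs⟩ (cs.wordProd ω) (x, z) =
      (cs.wordProd ω * x * (cs.wordProd ω)⁻¹, z + ((cs.rightInvSeq ω).count x : ZMod 2)) := by
  induction ω with
  | nil => simp; rfl
  | cons i ω ih =>
    rw [wordProd_cons, map_mul, lift_apply_simple]
    change signAct cs i (cs.lift ⟨signAct cs, isLiftable_signAct cs⟩ (cs.wordProd ω) (x, z)) = _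
    rw [ih]
    have h : (cs.wordProd ω * x * (cs.wordProd ω)⁻¹ = cs.simple i) ↔
        (cs.wordProd ω)⁻¹ * cs.simple i * cs.wordProd ω = x := by
      constructor
      · intro h; rw [← h]; group
      · intro h; rw [← h]; group
    simp only [signAct, rightInvSeq, List.count_cons, if_congr h rfl rfl, beq_iff_eq]
    refine Prod.ext ?_ ?_
    · simp [mul_assoc]
    · push_cast; simp only [add_assoc]

/-- The sign cocycle: its value at `(w, s)` is `1` exactly if `s` is a right descent of `w`. -/
def signCocycle (w x : W) : ZMod 2 :=
  (cs.lift ⟨signAct cs, isLiftable_signAct cs⟩ w (x, 0)).2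

lemma lift_signAct_apply (w x : W) (z : ZMod 2) :
    cs.lift ⟨signAct cs, isLiftable_signAct cs⟩ w (x, z) =
      (w * x * w⁻¹, z + signCocycle cs w x) := by
  classical
  obtain ⟨ω, rfl⟩ := cs.wordProd_surjective w
  simp [signCocycle, lift_signAct_wordProd]

lemma signCocycle_mul (u w x : W) :
    signCocycle cs (u * w) x = signCocycle cs w x + signCocycle cs u (w * x * w⁻¹) := by
  rw [signCocycle, map_mul]
  change (cs.lift ⟨signAct cs, isLiftable_signAct cs⟩ u
    (cs.lift ⟨signAct cs, isLiftable_signAct cs⟩ w (x, 0))).2 = _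
  rw [lift_signAct_apply, lift_signAct_apply, zero_add]

open Classical in
lemma signCocycle_simple (i : B) (x : W) :
    signCocycle cs (cs.simple i) x = if x = cs.simple i then 1 else 0 := by
  rw [signCocycle, lift_apply_simple]
  simp [signAct]

lemma isRightDescent_of_signCocycle_ne_zero {w : W} {j : B}
    (h : signCocycle cs w (cs.simple j) ≠ 0) : cs.IsRightDescent w j := by
  classical
  obtain ⟨ω, hω, rfl⟩ := cs.exists_isReduced w
  rw [signCocycle, lift_signAct_wordProd] at h
  have : cs.simple j ∈ cs.rightInvSeq ω := by
    by_contra hn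
    rw [← List.count_eq_zero] at hn
    simp [hn] at h
  exact (cs.isRightInversion_simple_iff_isRightDescent _ _).1
    (cs.isRightInversion_of_mem_rightInvSeq hω this)

lemma isRightDescent_iff_signCocycle {w : W} {j : B} :
    cs.IsRightDescent w j ↔ signCocycle cs w (cs.simple j) = 1 := by
  have h2 : ∀ a : ZMod 2, a ≠ 0 ↔ a = 1 := by decide
  refine ⟨fun h ↦ ?_, fun h ↦ isRightDescent_of_signCocycle_ne_zero cs (by rw [h]; decide)⟩
  rw [← h2]
  intro h0
  rw [isRightDescent_iff_not_isRightDescent_mul] at h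
  refine h (isRightDescent_of_signCocycle_ne_zero cs ?_)
  rw [signCocycle_mul, signCocycle_simple]
  simp [h0]

lemma isRightDescent_simple_mul {w : W} {i j : B} (h : cs.simple i * w ≠ w * cs.simple j) :
    cs.IsRightDescent (cs.simple i * w) j ↔ cs.IsRightDescent w j := by
  rw [isRightDescent_iff_signCocycle, isRightDescent_iff_signCocycle, signCocycle_mul,
    signCocycle_simple, if_neg, add_zero]
  intro h'
  exact h (by rw [← h']; group)

lemma isLeftDescent_mul_simple {w : W} {i j : B} (h : cs.simple i * w ≠ w * cs.simple j) :
    cs.IsLeftDescent (w * cs.simple j) i ↔ cs.IsLeftDescent w i := by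
  rw [← isRightDescent_inv_iff, ← isRightDescent_inv_iff, mul_inv_rev, inv_simple]
  apply isRightDescent_simple_mul
  intro h'
  apply h
  have := congrArg (·⁻¹) h'
  simpa using this.symm

end Exchange

section Hecke

/-! ### The generic Iwahori-Hecke algebra over `A = ℤ[v, v⁻¹]` -/

variable {cs} (p : Weights cs)

/-- The generic Iwahori-Hecke algebra: as an `A`-module, it is free with a basis indexed by `W`.
Its product is introduced below. -/
def Hecke {cs : CoxeterSystem M W} (_p : Weights cs) : Type _ := W →₀ ℤ[T;T⁻¹]

instance : AddCommGroup (Hecke p) := inferInstanceAs (AddCommGroup (W →₀ ℤ[T;T⁻¹]))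

instance : Module ℤ[T;T⁻¹] (Hecke p) := inferInstanceAs (Module ℤ[T;T⁻¹] (W →₀ ℤ[T;T⁻¹]))

/-- The standard basis `T_w`. -/
def stdBasis : Module.Basis W ℤ[T;T⁻¹] (Hecke p) :=
  (Finsupp.basisSingleOne : Module.Basis W ℤ[T;T⁻¹] (W →₀ ℤ[T;T⁻¹]))

/-- The element `v ^ p_s - v ^ (-p_s)` of `A`. -/
def xi (i : B) : ℤ[T;T⁻¹] := LaurentPolynomial.T (p.wt i) - LaurentPolynomial.T (-p.wt i)

open Classical in
/-- Left multiplication by `T_s`: it sends `T_w` to `T_{sw}` if `sw > w`, and to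
`T_{sw} + (v ^ p_s - v ^ (-p_s)) T_w` if `sw < w`. -/
def leftMul (i : B) : Module.End ℤ[T;T⁻¹] (Hecke p) :=
  (stdBasis p).constr ℤ fun w ↦
    stdBasis p (cs.simple i * w) + if cs.IsLeftDescent w i then xi p i • stdBasis p w else 0

open Classical in
/-- Right multiplication by `T_s`. -/
def rightMul (i : B) : Module.End ℤ[T;T⁻¹] (Hecke p) :=
  (stdBasis p).constr ℤ fun w ↦
    stdBasis p (w * cs.simple i) + if cs.IsRightDescent w i then xi p i • stdBasis p w else 0

open Classical in
lemma leftMul_stdBasis (i : B) (w : W) : leftMul p i (stdBasis p w) =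
    stdBasis p (cs.simple i * w) + if cs.IsLeftDescent w i then xi p i • stdBasis p w else 0 := by
  simp [leftMul]

open Classical in
lemma rightMul_stdBasis (i : B) (w : W) : rightMul p i (stdBasis p w) =
    stdBasis p (w * cs.simple i) +
      if cs.IsRightDescent w i then xi p i • stdBasis p w else 0 := by
  simp [rightMul]

lemma leftMul_rightMul_comm (i j : B) : leftMul p i * rightMul p j = rightMul p j * leftMul p i := by
  classical
  refine (stdBasis p).ext fun w ↦ ?_
  rw [Module.End.mul_apply, Module.End.mul_apply, leftMul_stdBasis, rightMul_stdBasis]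
  by_cases h : cs.simple i * w = w * cs.simple j
  · have hp : xi p i = xi p j := by
      have : p.wt i = p.wt j := by
        apply p.wt_eq_of_isConj
        rw [isConj_comm, isConj_iff]
        exact ⟨w, by rw [← h]; group⟩
      simp [xi, this]
    have hl : cs.IsLeftDescent w i ↔ cs.IsRightDescent w j := by
      rw [IsLeftDescent, IsRightDescent, h]
    have hl' : cs.IsLeftDescent (w * cs.simple j) i ↔ ¬ cs.IsRightDescent w j := by
      rw [← h, ← hl, isLeftDescent_iff_not_isLeftDescent_mul]
      simp
    have hr' : cs.IsRightDescent (w * cs.simple j) j ↔ ¬ cs.IsRightDescent w j := by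
      rw [isRightDescent_iff_not_isRightDescent_mul]
      simp
    have h3 : cs.simple i * (w * cs.simple j) = w := by rw [← h]; simp
    by_cases hd : cs.IsRightDescent w j <;>
      simp [leftMul_stdBasis, rightMul_stdBasis, hl, hl', hr', hp, h, h3, hd]
  · have hl' := isLeftDescent_mul_simple cs h
    have hr' := isRightDescent_simple_mul cs h
    by_cases hd : cs.IsRightDescent w j <;> by_cases hd' : cs.IsLeftDescent w i <;>
      simp [leftMul_stdBasis, rightMul_stdBasis, hl', hr', hd, hd', mul_assoc, smul_smul,
        mul_comm (xi p i)]
    abel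

/-- The algebra of operators generated by the left multiplications by the `T_s`. -/
def leftOps : Subalgebra ℤ[T;T⁻¹] (Module.End ℤ[T;T⁻¹] (Hecke p)) :=
  Algebra.adjoin _ (Set.range (leftMul p))

/-- An operator in `leftOps` is evaluated at `T_1`. -/
def evalOne : leftOps p →ₗ[ℤ[T;T⁻¹]] Hecke p where
  toFun a := a.1 (stdBasis p 1)
  map_add' _ _ := rfl
  map_smul' _ _ := rfl

lemma leftOps_comm_rightMul {a : Module.End ℤ[T;T⁻¹] (Hecke p)} (ha : a ∈ leftOps p) (j : B) :
    a * rightMul p j = rightMul p j * a := by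
  induction ha using Algebra.adjoin_induction with
  | mem x hx => obtain ⟨i, rfl⟩ := hx; exact leftMul_rightMul_comm p i j
  | algebraMap r => exact Algebra.commutes r _
  | add x y _ _ hx hy => rw [add_mul, mul_add, hx, hy]
  | mul x y _ _ hx hy => rw [mul_assoc, hy, ← mul_assoc, hx, mul_assoc]

lemma evalOne_injective : Function.Injective (evalOne p) := by
  rw [injective_iff_map_eq_zero]
  rintro ⟨a, ha⟩ h0
  have h0' : a (stdBasis p 1) = 0 := h0
  suffices h : ∀ n w, cs.length w = n → a (stdBasis p w) = 0 by
    apply Subtype.ext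
    exact (stdBasis p).ext fun w ↦ by simpa using h _ w rfl
  intro n
  induction n with
  | zero => intro w hw; rw [cs.length_eq_zero_iff.1 hw]; exact h0'
  | succ n ih =>
    intro w hw
    have hw1 : w ≠ 1 := by rintro rfl; simp at hw
    obtain ⟨j, hj⟩ := cs.exists_rightDescent_of_ne_one hw1
    have hj' := hj
    rw [isRightDescent_iff_not_isRightDescent_mul] at hj'
    have hlen := cs.isRightDescent_iff.1 hj
    have e := rightMul_stdBasis p j (w * cs.simple j)
    rw [if_neg hj'] at e
    simp only [simple_mul_simple_cancel_right, add_zero] at e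
    rw [← e, ← Module.End.mul_apply, leftOps_comm_rightMul p ha, Module.End.mul_apply,
      ih (w * cs.simple j) (by omega), map_zero]

lemma evalOne_surjective : Function.Surjective (evalOne p) := by
  rw [← LinearMap.range_eq_top, ← top_le_iff, ← (stdBasis p).span_eq, Submodule.span_le]
  suffices h : ∀ n w, cs.length w = n → ∃ a, evalOne p a = stdBasis p w by
    rintro _ ⟨w, rfl⟩
    exact h _ w rfl
  intro n
  induction n with
  | zero => intro w hw; rw [cs.length_eq_zero_iff.1 hw]; exact ⟨1, rfl⟩
  | succ n ih =>
    intro w hw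
    have hw1 : w ≠ 1 := by rintro rfl; simp at hw
    obtain ⟨i, hi⟩ := cs.exists_leftDescent_of_ne_one hw1
    have hi' := hi
    rw [isLeftDescent_iff_not_isLeftDescent_mul] at hi'
    have hlen := cs.isLeftDescent_iff.1 hi
    obtain ⟨a, ha⟩ := ih (cs.simple i * w) (by omega)
    refine ⟨⟨leftMul p i, Algebra.subset_adjoin ⟨i, rfl⟩⟩ * a, ?_⟩
    change leftMul p i (evalOne p a) = _
    rw [ha, leftMul_stdBasis, if_neg hi']
    simp

/-- The left regular representation: it sends `h` to the operator of left multiplication by `h`,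
which is the unique element of `leftOps` that sends `T_1` to `h`. -/
def regRep : Hecke p ≃ₗ[ℤ[T;T⁻¹]] leftOps p :=
  (LinearEquiv.ofBijective (evalOne p) ⟨evalOne_injective p, evalOne_surjective p⟩).symm

instance : One (Hecke p) := ⟨stdBasis p 1⟩

instance : Mul (Hecke p) := ⟨fun x y ↦ (regRep p x).1 y⟩

lemma mul_def (x y : Hecke p) : x * y = (regRep p x).1 y := rfl

lemma one_def : (1 : Hecke p) = stdBasis p 1 := rfl

lemma regRep_apply_one (x : Hecke p) : (regRep p x).1 (stdBasis p 1) = x :=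
  (LinearEquiv.ofBijective (evalOne p)
    ⟨evalOne_injective p, evalOne_surjective p⟩).apply_symm_apply x

lemma regRep_eq {x : Hecke p} {a : leftOps p} (h : a.1 (stdBasis p 1) = x) : regRep p x = a :=
  evalOne_injective p ((regRep_apply_one p x).trans h.symm)

lemma regRep_mul (x y : Hecke p) : regRep p (x * y) = regRep p x * regRep p y := by
  apply regRep_eq
  change (regRep p x).1 ((regRep p y).1 (stdBasis p 1)) = _
  rw [regRep_apply_one, mul_def]

instance : Ring (Hecke p) where
  __ := (inferInstance : AddCommGroup (Hecke p))
  left_distrib x y z := map_add (regRep p x).1 y z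
  right_distrib x y z := by simp [mul_def]
  zero_mul x := by simp [mul_def]
  mul_zero x := map_zero (regRep p x).1
  mul_assoc x y z := by
    rw [mul_def p (x * y), regRep_mul]
    rfl
  one_mul x := by
    rw [mul_def, regRep_eq p (x := 1) (a := 1) rfl]
    rfl
  mul_one x := regRep_apply_one p x

instance : Algebra ℤ[T;T⁻¹] (Hecke p) :=
  Algebra.ofModule
    (fun r x y ↦ by simp [mul_def])
    (fun r x y ↦ by simp [mul_def])

open Classical in
/-- The multiplication rule of the Hecke algebra. -/
theorem stdBasis_simple_mul (i : B) (w : W) :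
    stdBasis p (cs.simple i) * stdBasis p w =
      stdBasis p (cs.simple i * w) +
        if cs.IsLeftDescent w i then xi p i • stdBasis p w else 0 := by
  have h : regRep p (stdBasis p (cs.simple i)) =
      ⟨leftMul p i, Algebra.subset_adjoin ⟨i, rfl⟩⟩ := by
    apply regRep_eq
    rw [leftMul_stdBasis, if_neg (cs.not_isLeftDescent_one i)]
    simp
  rw [mul_def, h, leftMul_stdBasis]

theorem stdBasis_simple_mul_inv (i : B) :
    stdBasis p (cs.simple i) * (stdBasis p (cs.simple i) - xi p i • 1) = 1 := by
  have h := stdBasis_simple_mul p i (cs.simple i)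
  have hd : cs.IsLeftDescent (cs.simple i) i := by simp [CoxeterSystem.IsLeftDescent]
  rw [mul_sub, h, if_pos hd, mul_smul_comm, mul_one, simple_mul_simple_self, one_def]
  abel

theorem stdBasis_simple_inv_mul (i : B) :
    (stdBasis p (cs.simple i) - xi p i • 1) * stdBasis p (cs.simple i) = 1 := by
  refine Eq.trans ?_ (stdBasis_simple_mul_inv p i)
  rw [sub_mul, mul_sub, mul_smul_comm, smul_mul_assoc, mul_one, one_mul]

theorem isUnit_stdBasis (w : W) : IsUnit (stdBasis p w) := by
  suffices h : ∀ n w, cs.length w = n → IsUnit (stdBasis p w) from h _ w rfl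
  intro n
  induction n with
  | zero => intro w hw; rw [cs.length_eq_zero_iff.1 hw]; exact isUnit_one
  | succ n ih =>
    intro w hw
    have hw1 : w ≠ 1 := by rintro rfl; simp at hw
    obtain ⟨i, hi⟩ := cs.exists_leftDescent_of_ne_one hw1
    have hi' := hi
    rw [isLeftDescent_iff_not_isLeftDescent_mul] at hi'
    have hlen := cs.isLeftDescent_iff.1 hi
    have h := stdBasis_simple_mul p i (cs.simple i * w)
    rw [if_neg hi', simple_mul_simple_cancel_left, add_zero] at h
    rw [← h]
    exact .mul ⟨⟨_, _, stdBasis_simple_mul_inv p i, stdBasis_simple_inv_mul p i⟩, rfl⟩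
      (ih _ (by omega))

end Hecke

section Cells

/-! ### The Kazhdan-Lusztig basis, left cells and enhanced right descent sets -/

variable {cs} (p : Weights cs)

/-- The bar involution of `ℋ`: it sends `∑ a_w T_w` to `∑ a̅_w (T_{w⁻¹})⁻¹`, where the bar on `A`
interchanges `v` and `v⁻¹`. (Every `T_w` is a unit.) -/
def bar (h : Hecke p) : Hecke p :=
  ((stdBasis p).repr h).sum fun w a ↦
    LaurentPolynomial.invert a • Ring.inverse (stdBasis p w⁻¹)

/-- `c` is bar-invariant, and all coefficients of `c - T_w` in the standard basis lie in
`A_{<0}`, the span of the `v ^ n` with `n < 0`. -/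
def IsKL (w : W) (c : Hecke p) : Prop :=
  bar p c = c ∧ ∀ (y : W) (n : ℤ), 0 ≤ n → ((stdBasis p).repr (c - stdBasis p w) y).coeff n = 0

/-- The element `C'_w` of the Kazhdan-Lusztig basis: the unique element with the property
`IsKL`. -/
def klElt (w : W) : Hecke p := Classical.epsilon (IsKL p w)

/-- `x ←_L y`: there is a simple reflection `s` such that `C'_x` occurs, with a non-zero
coefficient `h_{s,y,x}`, in the expansion of `C'_s C'_y` in the basis `(C'_z)`. -/
def LeftArrow (x y : W) : Prop :=
  ∃ (i : B) (h : W →₀ ℤ[T;T⁻¹]),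
    klElt p (cs.simple i) * klElt p y = h.sum (fun z a ↦ a • klElt p z) ∧ h x ≠ 0

/-- The left pre-order `≤_L`, the reflexive and transitive closure of `←_L`. -/
def LeftLE (x y : W) : Prop := Relation.ReflTransGen (LeftArrow p) x y

/-- `x ∼_L y`: the elements `x` and `y` lie in the same left cell. -/
def LeftEquiv (x y : W) : Prop := LeftLE p x y ∧ LeftLE p y x

variable (cs) in
/-- The right descent set `{s ∈ S | ws < w}`. -/
def rightDescentSet (w : W) : Set W :=
  {x | ∃ i, x = cs.simple i ∧ BruhatLT cs (w * cs.simple i) w}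

/-- The enhanced right descent set `ℛ^π(w)`, the union of the right descent set and the set of
all `sts` with `s, t ∈ S`, `st ≠ ts`, `p_s < p_t` and `wsts < w`. -/
def enhancedRightDescentSet (w : W) : Set W :=
  rightDescentSet cs w ∪
    {x | ∃ i j, cs.simple i * cs.simple j ≠ cs.simple j * cs.simple i ∧ p.wt i < p.wt j ∧
      x = cs.simple i * cs.simple j * cs.simple i ∧
      BruhatLT cs (w * (cs.simple i * cs.simple j * cs.simple i)) w}

end Cells

end KLCell

end

/-!
# Left cells and enhanced right descent sets

That `ℛ^π` is constant on left cells follows from its monotonicity along `←_L`. For this it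
suffices to exhibit, for every condition `w s < w` and `w s t s < w` (with `p_s < p_t`), a left
ideal of `ℋ` that is spanned by the `C'_w` for which the condition holds: an element `C'_x` that
occurs in `C'_r C'_y` then lies in this ideal as soon as `C'_y` does, because the `C'_w` are
linearly independent.

These ideals are induced from parabolic subalgebras. Let `X_I` be the set of minimal left coset
representatives of the parabolic subgroup `W_I`, and suppose that some `C'_u`, `u ∈ U ⊆ W_I`, span
a left ideal of the parabolic subalgebra. By Deodhar's lemma (`simple_mul_mem_minReps_or`) the
elements `T_x C'_u` with `x ∈ X_I`, `u ∈ U` span a left ideal of `ℋ`. Running the Kazhdan-Lusztig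
algorithm inside this ideal gives bar-invariant elements which are congruent to `T_{xu}` modulo
coefficients in `v⁻¹ ℤ[v⁻¹]`, and which therefore are the `C'_{xu}`
(`IsLeftClosed.exists_isKL`); by triangularity they span the ideal (`IsLeftClosed.leftArrow`). The
case `I = ∅`, `U = {1}` is the existence of the Kazhdan-Lusztig basis itself.

The condition `w s < w` corresponds to `I = {s}`, `U = {s}`. The condition `w s t s < w`
corresponds to `I = {s, t}`, where `U` consists of the alternating products with at least two
factors that end in `s`, and of `w₀ s` if the dihedral group `W_I` is finite
(`length_mul_triple_lt_iff`). That `U` spans a left ideal (`isLeftClosed_triple`) is seen from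
explicit formulas. In the left ideal generated by `C'_i`, write `f_k = (T_i T_j)^k C'_i` (`dihStd`)
and let `Q_k`, `S_k` (`dihOddSum`, `dihEven`) be the sums of all `f_l`, `T_j f_l` up to a given
length, weighted by powers of `v`. Then
`C'_j Q_k = S_{k+1} + v^(p_j - p_i) S_k` and `C'_i S_{k+1} = Q_{k+1} + v^(p_i - p_j) Q_k`. The `S_k`
are Kazhdan-Lusztig elements, and so are certain combinations `dihOdd` of the `Q_k`, which depend on
the sign of `p_i - p_j`; this yields the multiplication of `C'_i` and `C'_j` with the dihedral
Kazhdan-Lusztig elements.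

For dihedral groups, the same formulas provide enough relations `←_L` to connect any two alternating
products with the same value of `ℛ^π`.
-/

open scoped LaurentPolynomial

noncomputable section

namespace KLCell

open CoxeterSystem

/-- The powers of the indeterminate `v` of `A = ℤ[v, v⁻¹]`. -/
local notation "𝐯" => (LaurentPolynomial.T : ℤ → ℤ[T;T⁻¹])

section HeckeBasics

/-! ### Multiplication of standard basis elements -/

variable {B W : Type*} [Group W] {M : CoxeterMatrix B} {cs : CoxeterSystem M W} (p : Weights cs)

lemma stdBasis_simple_mul_of_lt {i : B} {w : W} (h : ¬ cs.IsLeftDescent w i) :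
    stdBasis p (cs.simple i) * stdBasis p w = stdBasis p (cs.simple i * w) := by
  rw [stdBasis_simple_mul, if_neg h, add_zero]

lemma stdBasis_simple_mul_of_gt {i : B} {w : W} (h : cs.IsLeftDescent w i) :
    stdBasis p (cs.simple i) * stdBasis p w =
      stdBasis p (cs.simple i * w) + xi p i • stdBasis p w := by
  rw [stdBasis_simple_mul, if_pos h]

lemma stdBasis_simple_sq (i : B) :
    stdBasis p (cs.simple i) * stdBasis p (cs.simple i) =
      1 + xi p i • stdBasis p (cs.simple i) := by
  rw [stdBasis_simple_mul_of_gt p (by simp [CoxeterSystem.IsLeftDescent]), simple_mul_simple_self,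
    one_def]

lemma stdBasis_simple_mul_mul (i : B) (h : Hecke p) :
    stdBasis p (cs.simple i) * (stdBasis p (cs.simple i) * h) =
      h + xi p i • (stdBasis p (cs.simple i) * h) := by
  rw [← mul_assoc, stdBasis_simple_sq, add_mul, one_mul, smul_mul_assoc]

lemma stdBasis_mul_of_length_add {x u : W} (h : cs.length (x * u) = cs.length x + cs.length u) :
    stdBasis p x * stdBasis p u = stdBasis p (x * u) := by
  induction hn : cs.length x generalizing x with
  | zero => rw [cs.length_eq_zero_iff.1 hn, one_mul, ← one_def, one_mul]
  | succ n ih =>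
    have hx1 : x ≠ 1 := by rintro rfl; simp at hn
    obtain ⟨i, hi⟩ := cs.exists_leftDescent_of_ne_one hx1
    have hlen := cs.isLeftDescent_iff.1 hi
    have h1 := cs.length_mul_le (cs.simple i * x) u
    have h2 : cs.length (x * u) ≤ cs.length (cs.simple i * x * u) + 1 := by
      rcases cs.length_simple_mul (x * u) i with h | h <;> rw [mul_assoc] <;> omega
    have e := ih (x := cs.simple i * x) (by omega) (by omega)
    have hd : ¬ cs.IsLeftDescent (cs.simple i * x) i := by
      rw [isLeftDescent_iff_not_isLeftDescent_mul] at hi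
      exact hi
    have hd' : ¬ cs.IsLeftDescent (cs.simple i * x * u) i := by
      rw [cs.not_isLeftDescent_iff, ← mul_assoc, simple_mul_simple_cancel_left]
      omega
    have e1 := stdBasis_simple_mul_of_lt p hd
    have e2 := stdBasis_simple_mul_of_lt p hd'
    rw [simple_mul_simple_cancel_left] at e1
    rw [← mul_assoc (cs.simple i), simple_mul_simple_cancel_left] at e2
    rw [← e1, mul_assoc, e, e2]

lemma hecke_induction {P : Hecke p → Prop} (std : ∀ w, P (stdBasis p w)) (zero : P 0)
    (add : ∀ x y, P x → P y → P (x + y)) (smul : ∀ (a : ℤ[T;T⁻¹]) x, P x → P (a • x))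
    (h : Hecke p) : P h := by
  have hh : h ∈ Submodule.span ℤ[T;T⁻¹] (Set.range (stdBasis p)) := by
    rw [(stdBasis p).span_eq]; trivial
  induction hh using Submodule.span_induction with
  | mem x hx => obtain ⟨w, rfl⟩ := hx; exact std w
  | zero => exact zero
  | add x y _ _ hx hy => exact add x y hx hy
  | smul a x _ hx => exact smul a x hx

/-! ### The bar involution -/

lemma bar_zero : bar p 0 = 0 := by simp [bar]

lemma bar_add (x y : Hecke p) : bar p (x + y) = bar p x + bar p y := by
  unfold bar
  rw [map_add]
  exact Finsupp.sum_add_index' (fun _ ↦ by simp) (fun _ _ _ ↦ by rw [map_add, add_smul])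

lemma bar_smul (a : ℤ[T;T⁻¹]) (x : Hecke p) :
    bar p (a • x) = LaurentPolynomial.invert a • bar p x := by
  unfold bar
  rw [map_smul, Finsupp.sum_smul_index (fun _ ↦ by simp), Finsupp.smul_sum]
  simp [mul_smul]

lemma bar_stdBasis (w : W) : bar p (stdBasis p w) = Ring.inverse (stdBasis p w⁻¹) := by
  simp [bar]

lemma bar_neg (x : Hecke p) : bar p (-x) = -bar p x := by
  simpa using bar_smul p (-1) x

lemma bar_sub (x y : Hecke p) : bar p (x - y) = bar p x - bar p y := by
  rw [sub_eq_add_neg, bar_add, bar_neg, sub_eq_add_neg]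

lemma bar_one : bar p 1 = 1 := by
  rw [one_def, bar_stdBasis, inv_one, ← one_def, Ring.inverse_one]

lemma inverse_eq_of_mul_eq_one {R : Type*} [Ring R] {a b : R} (hu : IsUnit a) (h : a * b = 1) :
    Ring.inverse a = b := by
  rw [← mul_one (Ring.inverse a), ← h, ← mul_assoc, Ring.inverse_mul_cancel a hu, one_mul]

lemma bar_stdBasis_simple_mul_of_lt {i : B} {w : W} (h : ¬ cs.IsLeftDescent w i) :
    bar p (stdBasis p (cs.simple i * w)) =
      (stdBasis p (cs.simple i) - xi p i • 1) * bar p (stdBasis p w) := by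
  rw [bar_stdBasis, bar_stdBasis]
  apply inverse_eq_of_mul_eq_one (isUnit_stdBasis p _)
  have e : stdBasis p (w⁻¹) * stdBasis p (cs.simple i) = stdBasis p ((cs.simple i * w)⁻¹) := by
    rw [stdBasis_mul_of_length_add, mul_inv_rev, inv_simple]
    rw [cs.not_isLeftDescent_iff] at h
    rw [length_simple, length_inv, ← h, ← length_inv, mul_inv_rev, inv_inv, inv_simple]
  rw [← e, mul_assoc, ← mul_assoc (stdBasis p (cs.simple i)), stdBasis_simple_mul_inv, one_mul,
    Ring.mul_inverse_cancel _ (isUnit_stdBasis p _)]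

lemma invert_xi (i : B) : LaurentPolynomial.invert (xi p i) = -xi p i := by
  simp [xi]

lemma bar_simple_mul (i : B) (h : Hecke p) :
    bar p (stdBasis p (cs.simple i) * h) =
      (stdBasis p (cs.simple i) - xi p i • 1) * bar p h := by
  induction h using hecke_induction with
  | zero => simp [bar_zero]
  | add x y hx hy => rw [mul_add, bar_add, bar_add, hx, hy, mul_add]
  | smul a x hx => rw [mul_smul_comm, bar_smul, bar_smul, hx, mul_smul_comm]
  | std w =>
    by_cases h : cs.IsLeftDescent w i
    · rw [stdBasis_simple_mul_of_gt p h, bar_add, bar_smul, invert_xi]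
      have h' := h
      rw [isLeftDescent_iff_not_isLeftDescent_mul] at h'
      have e := bar_stdBasis_simple_mul_of_lt p h'
      rw [simple_mul_simple_cancel_left] at e
      rw [e]
      simp only [sub_mul, smul_mul_assoc, one_mul, mul_sub, mul_smul_comm, stdBasis_simple_mul_mul]
      module
    · rw [stdBasis_simple_mul_of_lt p h, bar_stdBasis_simple_mul_of_lt p h]

/-- The element `T_s + v ^ (-p_s)`, which is `C'_s` if `p_s > 0` (`klElt_simple`). -/
def klSimple (i : B) : Hecke p :=
  stdBasis p (cs.simple i) + 𝐯 (-p.wt i) • (1 : Hecke p)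

lemma klSimple_mul (i : B) (h : Hecke p) : klSimple p i * h =
    stdBasis p (cs.simple i) * h + 𝐯 (-p.wt i) • h := by
  rw [klSimple, add_mul, smul_mul_assoc, one_mul]

lemma bar_klSimple_mul (i : B) (h : Hecke p) :
    bar p (klSimple p i * h) = klSimple p i * bar p h := by
  rw [klSimple_mul, klSimple_mul, bar_add, bar_smul, bar_simple_mul, sub_mul, smul_mul_assoc,
    one_mul, LaurentPolynomial.invert_T, neg_neg, xi]
  module

lemma bar_klSimple (i : B) : bar p (klSimple p i) = klSimple p i := by
  simpa [bar_one] using bar_klSimple_mul p i 1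

/-- The span of the `T_y` with `ℓ(y) < n`. -/
def lowerSpan (n : ℕ) : Submodule ℤ[T;T⁻¹] (Hecke p) :=
  Submodule.span _ (stdBasis p '' {y | cs.length y < n})

lemma repr_eq_zero_of_mem_lowerSpan {n : ℕ} {h : Hecke p} (hh : h ∈ lowerSpan p n) {w : W}
    (hw : n ≤ cs.length w) : (stdBasis p).repr h w = 0 := by
  rw [lowerSpan, Module.Basis.mem_span_image] at hh
  by_contra h0
  have := hh (Finsupp.mem_support_iff.2 h0)
  simp only [Set.mem_ofPred_eq] at this
  omega

lemma lowerSpan_mono {m n : ℕ} (h : m ≤ n) : lowerSpan p m ≤ lowerSpan p n :=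
  Submodule.span_mono (Set.image_mono fun _ hy ↦ lt_of_lt_of_le hy h)

lemma stdBasis_simple_mul_mem_lowerSpan (i : B) {n : ℕ} {h : Hecke p} (hh : h ∈ lowerSpan p n) :
    stdBasis p (cs.simple i) * h ∈ lowerSpan p (n + 1) := by
  induction hh using Submodule.span_induction with
  | zero => simp
  | add x y _ _ hx hy => rw [mul_add]; exact add_mem hx hy
  | smul a x _ hx => rw [mul_smul_comm]; exact Submodule.smul_mem _ _ hx
  | mem x hx =>
    obtain ⟨y, hy, rfl⟩ := hx
    simp only [Set.mem_ofPred_eq] at hy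
    have h1 : stdBasis p (cs.simple i * y) ∈ lowerSpan p (n + 1) := by
      refine Submodule.subset_span ⟨_, ?_, rfl⟩
      rcases cs.length_simple_mul y i with h | h <;> simp only [Set.mem_ofPred_eq] <;> omega
    by_cases hd : cs.IsLeftDescent y i
    · rw [stdBasis_simple_mul_of_gt p hd]
      exact add_mem h1 (Submodule.smul_mem _ _
        (Submodule.subset_span ⟨_, Nat.lt_succ_of_lt hy, rfl⟩))
    · rwa [stdBasis_simple_mul_of_lt p hd]

/-- The bar involution is unitriangular for the standard basis. -/
lemma bar_stdBasis_sub_mem (w : W) :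
    bar p (stdBasis p w) - stdBasis p w ∈ lowerSpan p (cs.length w) := by
  induction hn : cs.length w generalizing w with
  | zero => rw [cs.length_eq_zero_iff.1 hn, ← one_def, bar_one, sub_self]; exact zero_mem _
  | succ n ih =>
    have hx1 : w ≠ 1 := by rintro rfl; simp at hn
    obtain ⟨i, hi⟩ := cs.exists_leftDescent_of_ne_one hx1
    have hlen := cs.isLeftDescent_iff.1 hi
    rw [isLeftDescent_iff_not_isLeftDescent_mul] at hi
    have e1 := stdBasis_simple_mul_of_lt p hi
    have e2 := bar_stdBasis_simple_mul_of_lt p hi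
    rw [simple_mul_simple_cancel_left] at e1 e2
    have h := ih (cs.simple i * w) (by omega)
    have h1 : stdBasis p (cs.simple i * w) ∈ lowerSpan p (n + 1) :=
      Submodule.subset_span ⟨_, by simp only [Set.mem_ofPred_eq]; omega, rfl⟩
    rw [e2, ← e1]
    have h2 := stdBasis_simple_mul_mem_lowerSpan p i h
    have h3 := lowerSpan_mono p n.le_succ h
    have h4 := add_mem h3 h1
    have h5 := sub_mem h2 (Submodule.smul_mem _ (xi p i) h4)
    convert h5 using 1
    rw [sub_mul, smul_mul_assoc, one_mul, mul_sub]
    module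

/-! ### Degrees of coefficients and the uniqueness of the Kazhdan-Lusztig basis -/

/-- The elements of `ℋ` all of whose coefficients in the standard basis have degree at most `d`
as Laurent polynomials in `v`. -/
def degLE (d : ℤ) : AddSubgroup (Hecke p) where
  carrier := {h | ∀ w n, d < n → ((stdBasis p).repr h w).coeff n = 0}
  zero_mem' w n _ := by simp
  add_mem' {x y} hx hy w n hn := by simp [hx w n hn, hy w n hn]
  neg_mem' {x} hx w n hn := by simp [hx w n hn]

lemma degLE_mono {d e : ℤ} (h : d ≤ e) : degLE p d ≤ degLE p e :=
  fun _ hx w n hn ↦ hx w n (h.trans_lt hn)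

lemma T_smul_mem_degLE {d e n : ℤ} {h : Hecke p} (hh : h ∈ degLE p d) (he : d + n ≤ e) :
    𝐯 n • h ∈ degLE p e := by
  intro w m hm
  have := hh w (m - n) (by omega)
  rw [map_smul, Finsupp.smul_apply, smul_eq_mul, LaurentPolynomial.T,
    AddMonoidAlgebra.coeff_single_mul_apply, one_mul, ← this]
  congr 1
  ring

lemma smul_mem_degLE {d e : ℤ} {a : ℤ[T;T⁻¹]} (ha : ∀ n, d < n → a.coeff n = 0) {h : Hecke p}
    (hh : h ∈ degLE p e) : a • h ∈ degLE p (d + e) := by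
  rw [← AddMonoidAlgebra.sum_coeff_single a, Finsupp.sum, Finset.sum_smul]
  refine sum_mem fun n hn ↦ ?_
  rw [LaurentPolynomial.single_eq_C_mul_T, mul_smul, LaurentPolynomial.C_eq_algebraMap,
    algebraMap_smul]
  refine zsmul_mem (T_smul_mem_degLE p hh ?_) _
  by_contra hc
  exact Finsupp.mem_support_iff.1 hn (ha n (by omega))

lemma stdBasis_mem_degLE (w : W) : stdBasis p w ∈ degLE p 0 := by
  classical
  intro y n hn
  rw [Module.Basis.repr_self, Finsupp.single_apply]
  split_ifs
  · rw [← LaurentPolynomial.T_zero, LaurentPolynomial.T_apply, if_neg hn.ne]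
  · simp

lemma isKL_iff {w : W} {c : Hecke p} :
    IsKL p w c ↔ bar p c = c ∧ c - stdBasis p w ∈ degLE p (-1) := by
  refine and_congr_right fun _ ↦ forall₂_congr fun y n ↦ ?_
  rw [show (-1 : ℤ) < n ↔ 0 ≤ n by omega]

/-- At an index of maximal length in the support of `d`, the coefficient is invariant under
`v ↦ v⁻¹`, as the bar involution is unitriangular; being in `v⁻¹ ℤ[v⁻¹]`, it vanishes. -/
lemma eq_zero_of_bar_eq {d : Hecke p} (hb : bar p d = d) (hd : d ∈ degLE p (-1)) : d = 0 := by
  by_contra h0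
  have hne : ((stdBasis p).repr d).support.Nonempty := by
    rw [Finsupp.support_nonempty_iff]
    simpa using h0
  obtain ⟨w, hw, hmax⟩ := Finset.exists_max_image _ cs.length hne
  have key : (stdBasis p).repr (bar p d) w =
      LaurentPolynomial.invert ((stdBasis p).repr d w) := by
    unfold bar
    rw [Finsupp.sum, map_sum, Finsupp.finsetSum_apply, Finset.sum_eq_single w]
    · have := repr_eq_zero_of_mem_lowerSpan p (bar_stdBasis_sub_mem p w) le_rfl
      rw [map_sub, Finsupp.sub_apply, sub_eq_zero, bar_stdBasis] at this
      simp [this]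
    · intro y hy hyw
      have := repr_eq_zero_of_mem_lowerSpan p (bar_stdBasis_sub_mem p y) (hmax y hy)
      rw [map_sub, Finsupp.sub_apply, sub_eq_zero, bar_stdBasis] at this
      simp [this, hyw]
    · intro h; exact absurd hw h
  rw [hb] at key
  apply Finsupp.mem_support_iff.1 hw
  ext n
  rcases le_or_gt 0 n with hn | hn
  · rw [hd w n (by omega)]; simp
  · rw [key, LaurentPolynomial.invert_apply, hd w (-n) (by omega)]; simp

/-- Uniqueness of the elements of the Kazhdan-Lusztig basis. -/
lemma IsKL.unique {w : W} {c c' : Hecke p} (h : IsKL p w c) (h' : IsKL p w c') : c = c' := by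
  rw [isKL_iff] at h h'
  rw [← sub_eq_zero]
  apply eq_zero_of_bar_eq p
  · rw [bar_sub, h.1, h'.1]
  · convert sub_mem h.2 h'.2 using 1; abel

lemma IsKL.klElt_eq {w : W} {c : Hecke p} (h : IsKL p w c) : klElt p w = c :=
  IsKL.unique p (Classical.epsilon_spec ⟨c, h⟩) h

/-- A family of elements that agrees with the standard basis up to coefficients of negative degree
is linearly independent: look at the coefficients of maximal degree of a linear relation. -/
lemma linearIndependent_of_sub_mem_degLE {c : W → Hecke p}
    (hc : ∀ w, c w - stdBasis p w ∈ degLE p (-1)) : LinearIndependent ℤ[T;T⁻¹] c := by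
  rw [linearIndependent_iff]
  intro f hf
  rw [Finsupp.linearCombination_apply] at hf
  have step : ∀ d : ℤ, (∀ w n, d < n → (f w).coeff n = 0) →
      ∀ w n, d - 1 < n → (f w).coeff n = 0 := by
    intro d hd w n hn
    have h1 : f.sum (fun z a ↦ a • (c z - stdBasis p z)) ∈ degLE p (d + -1) :=
      sum_mem fun z _ ↦ smul_mem_degLE p (hd z) (hc z)
    have h2 : f.sum (fun z a ↦ a • (c z - stdBasis p z)) = -(stdBasis p).repr.symm f := by
      simp only [smul_sub]
      rw [Finsupp.sum_sub, hf, zero_sub, Module.Basis.repr_symm_apply,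
        Finsupp.linearCombination_apply]
    rw [h2] at h1
    have := neg_mem h1 w n (by omega)
    simpa using this
  have base : ∃ d : ℤ, ∀ w n, d < n → (f w).coeff n = 0 := by
    classical
    let s : Finset ℤ := f.support.biUnion fun w ↦ (f w).coeff.support
    obtain ⟨d, hd⟩ := s.bddAbove
    refine ⟨d, fun w n hn ↦ ?_⟩
    by_contra h0
    have : n ∈ s := by
      refine Finset.mem_biUnion.2 ⟨w, ?_, Finsupp.mem_support_iff.2 h0⟩
      rw [Finsupp.mem_support_iff]
      intro h1
      simp [h1] at h0
    exact absurd (hd this) (by simpa using hn)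
  obtain ⟨d, hd⟩ := base
  have all : ∀ k : ℕ, ∀ w n, d - k < n → (f w).coeff n = 0 := by
    intro k
    induction k with
    | zero => simpa using hd
    | succ k ih =>
      intro w n hn
      exact step _ ih w n (by push_cast at hn; omega)
  ext w n
  have := all ((d - n).toNat + 1) w n (by push_cast; omega)
  simpa using this

end HeckeBasics

section Parabolic

/-! ### Parabolic subgroups and minimal coset representatives -/

variable {B W : Type*} [Group W] {M : CoxeterMatrix B} (cs : CoxeterSystem M W)

/-- The set `X_I` of elements without right descents in `I`; by `isMin_of_mem_minReps` they are the
elements of minimal length in their left cosets with respect to the parabolic subgroup `W_I`. -/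
def minReps (I : Set B) : Set W := {x | ∀ i ∈ I, ¬ cs.IsRightDescent x i}

/-- The parabolic subgroup `W_I`. -/
def parabolic (I : Set B) : Subgroup W := Subgroup.closure (cs.simple '' I)

lemma simple_mem_parabolic {I : Set B} {i : B} (hi : i ∈ I) : cs.simple i ∈ parabolic cs I :=
  Subgroup.subset_closure ⟨i, hi, rfl⟩

lemma wordProd_mem_parabolic {I : Set B} {ω : List B} (h : ∀ i ∈ ω, i ∈ I) :
    cs.wordProd ω ∈ parabolic cs I := by
  induction ω with
  | nil => simp
  | cons i ω ih =>
    rw [wordProd_cons]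
    exact mul_mem (simple_mem_parabolic cs (h i (by simp))) (ih fun j hj ↦ h j (by simp [hj]))

lemma mem_rightInvSeq_of_signCocycle_ne_zero {ω : List B} {t : W}
    (h : signCocycle cs (cs.wordProd ω) t ≠ 0) : t ∈ cs.rightInvSeq ω := by
  classical
  rw [signCocycle, lift_signAct_wordProd] at h
  by_contra hn
  rw [← List.count_eq_zero] at hn
  simp [hn] at h

/-- The exchange property. -/
lemma exists_wordProd_eraseIdx {ω : List B} {i : B} (h : cs.IsRightDescent (cs.wordProd ω) i) :
    ∃ k < ω.length, cs.wordProd ω * cs.simple i = cs.wordProd (ω.eraseIdx k) := by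
  have hm : cs.simple i ∈ cs.rightInvSeq ω := by
    apply mem_rightInvSeq_of_signCocycle_ne_zero
    rw [(isRightDescent_iff_signCocycle cs).1 h]
    decide
  obtain ⟨k, hk, hk'⟩ := List.mem_iff_getElem.1 hm
  rw [length_rightInvSeq] at hk
  refine ⟨k, hk, ?_⟩
  rw [← wordProd_mul_getD_rightInvSeq, ← hk', List.getD_eq_getElem]

lemma exists_isReduced_of_mem_parabolic {I : Set B} {u : W} (hu : u ∈ parabolic cs I) :
    ∃ ω : List B, (∀ i ∈ ω, i ∈ I) ∧ cs.IsReduced ω ∧ u = cs.wordProd ω := by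
  have step : ∀ (u : W) (i : B), i ∈ I →
      (∃ ω : List B, (∀ i ∈ ω, i ∈ I) ∧ cs.IsReduced ω ∧ u = cs.wordProd ω) →
      ∃ ω : List B, (∀ i ∈ ω, i ∈ I) ∧ cs.IsReduced ω ∧ u * cs.simple i = cs.wordProd ω := by
    rintro _ i hi ⟨ω, hωI, hω, rfl⟩
    by_cases hd : cs.IsRightDescent (cs.wordProd ω) i
    · obtain ⟨k, hk, e⟩ := exists_wordProd_eraseIdx cs hd
      refine ⟨_, fun j hj ↦ hωI j (List.mem_of_mem_eraseIdx hj), ?_, e⟩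
      rw [cs.isRightDescent_iff, hω.eq] at hd
      rw [CoxeterSystem.IsReduced, ← e, List.length_eraseIdx_of_lt hk]
      omega
    · refine ⟨ω ++ [i], ?_, ?_, by rw [wordProd_append, wordProd_singleton]⟩
      · intro j hj
        rcases List.mem_append.1 hj with hj | hj
        · exact hωI j hj
        · rw [List.mem_singleton.1 hj]; exact hi
      · rw [CoxeterSystem.IsReduced, wordProd_append, wordProd_singleton,
          cs.not_isRightDescent_iff.1 hd, hω.eq, List.length_append, List.length_singleton]
  induction hu using Subgroup.closure_induction_right with
  | one => exact ⟨[], by simp, by simp [CoxeterSystem.IsReduced], by simp⟩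
  | mul_right u _ y hy h =>
    obtain ⟨i, hi, rfl⟩ := hy
    exact step u i hi h
  | mul_inv_cancel u _ y hy h =>
    obtain ⟨i, hi, rfl⟩ := hy
    rw [inv_simple]
    exact step u i hi h

lemma exists_isMin_coset (I : Set B) (w : W) :
    ∃ x, (∀ u ∈ parabolic cs I, cs.length x ≤ cs.length (x * u)) ∧
      ∃ u ∈ parabolic cs I, w = x * u := by
  obtain ⟨x, ⟨u, hu, rfl⟩, hmin⟩ := exists_minimalFor_of_wellFoundedLT
    (fun x ↦ ∃ u ∈ parabolic cs I, w = x * u) cs.length ⟨w, 1, one_mem _, by simp⟩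
  refine ⟨x, fun a ha ↦ ?_, u, hu, rfl⟩
  by_contra hlt
  exact hlt (hmin (j := x * a) ⟨a⁻¹ * u, mul_mem (inv_mem ha) hu, by group⟩ (by omega))

lemma length_mul_of_isMin {I : Set B} {x : W}
    (hx : ∀ u ∈ parabolic cs I, cs.length x ≤ cs.length (x * u)) {ω : List B}
    (hωI : ∀ i ∈ ω, i ∈ I) (hω : cs.IsReduced ω) :
    cs.length (x * cs.wordProd ω) = cs.length x + ω.length := by
  induction ω using List.reverseRecOn with
  | nil => simp
  | append_singleton ω i ih =>
    have hωI' : ∀ j ∈ ω, j ∈ I := fun j hj ↦ hωI j (by simp [hj])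
    have hi : i ∈ I := hωI i (by simp)
    have hω' : cs.IsReduced ω := by simpa using hω.take ω.length
    have h1 : ¬ cs.IsRightDescent (cs.wordProd ω) i := by
      rw [cs.not_isRightDescent_iff, ← wordProd_singleton, ← wordProd_append, hω.eq, hω'.eq]
      simp
    have h2 : ¬ cs.IsRightDescent (x * cs.wordProd ω) i := by
      rw [isRightDescent_iff_signCocycle] at h1 ⊢
      rw [signCocycle_mul]
      suffices h : signCocycle cs x (cs.wordProd ω * cs.simple i * (cs.wordProd ω)⁻¹) = 0 by
        rwa [h, add_zero]
      -- a non-trivial sign would make this reflection of `W_I` an inversion of `x`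
      by_contra h0
      obtain ⟨η, hη, rfl⟩ := cs.exists_isReduced x
      have h3 := cs.isRightInversion_of_mem_rightInvSeq hη
        (mem_rightInvSeq_of_signCocycle_ne_zero cs h0)
      have hm := wordProd_mem_parabolic cs hωI'
      exact absurd h3.2 (not_lt.2 (hx _ (mul_mem (mul_mem hm (simple_mem_parabolic cs hi))
        (inv_mem hm))))
    rw [wordProd_append, wordProd_singleton, ← mul_assoc, cs.not_isRightDescent_iff.1 h2,
      ih hωI' hω', List.length_append, List.length_singleton, add_assoc]

lemma isMin_of_mem_minReps {I : Set B} {x : W} (hx : x ∈ minReps cs I) :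
    ∀ u ∈ parabolic cs I, cs.length x ≤ cs.length (x * u) := by
  obtain ⟨y, hy, u, hu, rfl⟩ := exists_isMin_coset cs I x
  obtain ⟨ω, hωI, hω, rfl⟩ := exists_isReduced_of_mem_parabolic cs hu
  rcases List.eq_nil_or_concat' ω with rfl | ⟨ω, i, rfl⟩
  · simpa using hy
  · have hωI' : ∀ j ∈ ω, j ∈ I := fun j hj ↦ hωI j (by simp [hj])
    have hω' : cs.IsReduced ω := by simpa using hω.take ω.length
    exfalso
    apply hx i (hωI i (by simp))
    have e : y * cs.wordProd (ω ++ [i]) * cs.simple i = y * cs.wordProd ω := by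
      rw [wordProd_append, wordProd_singleton, ← mul_assoc, simple_mul_simple_cancel_right]
    rw [CoxeterSystem.IsRightDescent, e, length_mul_of_isMin cs hy hωI hω,
      length_mul_of_isMin cs hy hωI' hω']
    simp

lemma length_mul_of_mem_minReps {I : Set B} {x u : W} (hx : x ∈ minReps cs I)
    (hu : u ∈ parabolic cs I) : cs.length (x * u) = cs.length x + cs.length u := by
  obtain ⟨ω, hωI, hω, rfl⟩ := exists_isReduced_of_mem_parabolic cs hu
  rw [length_mul_of_isMin cs (isMin_of_mem_minReps cs hx) hωI hω, hω.eq]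

lemma exists_minReps_mul (I : Set B) (w : W) :
    ∃ x ∈ minReps cs I, ∃ u ∈ parabolic cs I, w = x * u := by
  obtain ⟨x, hx, u, hu, rfl⟩ := exists_isMin_coset cs I w
  exact ⟨x, fun i hi ↦ not_lt.2 (hx _ (simple_mem_parabolic cs hi)), u, hu, rfl⟩

lemma one_mem_minReps (I : Set B) : (1 : W) ∈ minReps cs I :=
  fun i _ ↦ cs.not_isRightDescent_one i

/-- Deodhar's lemma. -/
lemma simple_mul_mem_minReps_or {I : Set B} {x : W} (hx : x ∈ minReps cs I) (r : B) :
    cs.simple r * x ∈ minReps cs I ∨ ∃ i ∈ I, cs.simple r * x = x * cs.simple i := by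
  by_contra! h
  apply h.1
  intro i hi
  rw [isRightDescent_simple_mul cs (h.2 i hi)]
  exact hx i hi

lemma simple_mul_mem_minReps {I : Set B} {x : W} (hx : x ∈ minReps cs I) {r : B}
    (hr : cs.IsLeftDescent x r) : cs.simple r * x ∈ minReps cs I := by
  refine (simple_mul_mem_minReps_or cs hx r).resolve_right ?_
  rintro ⟨i, hi, e⟩
  apply hx i hi
  rwa [CoxeterSystem.IsRightDescent, ← e]

end Parabolic

section Induction

/-! ### Induction of left ideals from parabolic subalgebras -/

variable {B W : Type*} [Group W] {M : CoxeterMatrix B} {cs : CoxeterSystem M W} (p : Weights cs)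

/-- Bar-invariant elements `c_b` which play the role of the `C'_{u_b}` for certain elements `u_b`
of the parabolic subgroup `W_I`, and which span a left ideal of the parabolic subalgebra. Instead of
locating the support of `c_b` in `W_I`, the condition on the leading term is imposed after every
multiplication by `T_y` with `y ∈ X_I`, which is the form in which it is used. -/
structure IsLeftClosed (I : Set B) {ι : Type*} (u : ι → W) (c : ι → Hecke p) : Prop where
  bar_eq : ∀ b, bar p (c b) = c b
  std_mul_sub_mem : ∀ b, ∀ y ∈ minReps cs I,
    stdBasis p y * c b - stdBasis p (y * u b) ∈ degLE p (-1)
  simple_mul_mem_span : ∀ b, ∀ i ∈ I,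
    stdBasis p (cs.simple i) * c b ∈ Submodule.span ℤ[T;T⁻¹] (Set.range c)

/-- The span of the `T_y c_b` with `y ∈ X_I` and `ℓ(y) < n`. -/
def indSpan (I : Set B) {ι : Type*} (c : ι → Hecke p) (n : ℕ) : Submodule ℤ[T;T⁻¹] (Hecke p) :=
  Submodule.span _ {h | ∃ y ∈ minReps cs I, ∃ b, cs.length y < n ∧ h = stdBasis p y * c b}

variable {I : Set B} {ι : Type*} {u : ι → W} {c : ι → Hecke p}

lemma indSpan_mono {m n : ℕ} (h : m ≤ n) : indSpan p I c m ≤ indSpan p I c n :=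
  Submodule.span_mono fun _ ⟨y, hy, b, hl, e⟩ ↦ ⟨y, hy, b, lt_of_lt_of_le hl h, e⟩

lemma mul_mem_indSpan {y : W} (hy : y ∈ minReps cs I) (b : ι) {n : ℕ} (hn : cs.length y < n) :
    stdBasis p y * c b ∈ indSpan p I c n :=
  Submodule.subset_span ⟨y, hy, b, hn, rfl⟩

lemma IsLeftClosed.simple_mul_mem (F : IsLeftClosed p I u c) (r : B) {n : ℕ} {h : Hecke p}
    (hh : h ∈ indSpan p I c n) : stdBasis p (cs.simple r) * h ∈ indSpan p I c (n + 1) := by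
  induction hh using Submodule.span_induction with
  | zero => simp
  | add x y _ _ hx hy => rw [mul_add]; exact add_mem hx hy
  | smul a x _ hx => rw [mul_smul_comm]; exact Submodule.smul_mem _ _ hx
  | mem x hx =>
    obtain ⟨y, hy, b, hl, rfl⟩ := hx
    rw [← mul_assoc]
    by_cases hd : cs.IsLeftDescent y r
    · have hd' := cs.isLeftDescent_iff.1 hd
      rw [stdBasis_simple_mul_of_gt p hd, add_mul, smul_mul_assoc]
      exact add_mem (mul_mem_indSpan p (simple_mul_mem_minReps cs hy hd) b (by omega))
        (Submodule.smul_mem _ _ (mul_mem_indSpan p hy b (by omega)))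
    · have hd' := cs.not_isLeftDescent_iff.1 hd
      rw [stdBasis_simple_mul_of_lt p hd]
      rcases simple_mul_mem_minReps_or cs hy r with h | ⟨i, hi, e⟩
      · exact mul_mem_indSpan p h b (by omega)
      · rw [e, ← stdBasis_mul_of_length_add p
          (length_mul_of_mem_minReps cs hy (simple_mem_parabolic cs hi)), mul_assoc]
        have := F.simple_mul_mem_span b i hi
        generalize stdBasis p (cs.simple i) * c b = z at this
        induction this using Submodule.span_induction with
        | zero => simp
        | add x z _ _ hx hz => rw [mul_add]; exact add_mem hx hz
        | smul a x _ hx => rw [mul_smul_comm]; exact Submodule.smul_mem _ _ hx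
        | mem x hx => obtain ⟨b', rfl⟩ := hx; exact mul_mem_indSpan p hy b' (by omega)

lemma IsLeftClosed.klSimple_mul_mem (F : IsLeftClosed p I u c) (r : B) {n : ℕ} {h : Hecke p}
    (hh : h ∈ indSpan p I c n) : klSimple p r * h ∈ indSpan p I c (n + 1) := by
  rw [klSimple_mul]
  exact add_mem (F.simple_mul_mem p r hh) (Submodule.smul_mem _ _ (indSpan_mono p n.le_succ hh))

/-- Every Laurent polynomial is congruent to a symmetric one modulo `v⁻¹ ℤ[v⁻¹]`. -/
lemma exists_invert_eq (a : ℤ[T;T⁻¹]) : ∃ γ : ℤ[T;T⁻¹], LaurentPolynomial.invert γ = γ ∧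
    ∀ n, -1 < n → (a - γ).coeff n = 0 := by
  induction a using LaurentPolynomial.induction_on' with
  | add a b ha hb =>
    obtain ⟨γ, h1, h2⟩ := ha
    obtain ⟨δ, h3, h4⟩ := hb
    refine ⟨γ + δ, by rw [map_add, h1, h3], fun n hn ↦ ?_⟩
    rw [add_sub_add_comm, AddMonoidAlgebra.coeff_add, Finsupp.add_apply, h2 n hn, h4 n hn, add_zero]
  | C_mul_T n a =>
    rcases lt_trichotomy n 0 with hn | rfl | hn
    · refine ⟨0, by simp, fun m hm ↦ ?_⟩
      rw [sub_zero, ← LaurentPolynomial.single_eq_C_mul_T, AddMonoidAlgebra.coeff_single,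
        Finsupp.single_apply, if_neg (by omega)]
    · exact ⟨LaurentPolynomial.C a, by simp, fun m hm ↦ by simp⟩
    · refine ⟨LaurentPolynomial.C a * 𝐯 n + LaurentPolynomial.C a * 𝐯 (-n), ?_, fun m hm ↦ ?_⟩
      · rw [map_add, map_mul, map_mul]; simp [add_comm]
      · rw [sub_add_cancel_left, ← LaurentPolynomial.single_eq_C_mul_T,
          AddMonoidAlgebra.coeff_neg, Finsupp.neg_apply, AddMonoidAlgebra.coeff_single,
          Finsupp.single_apply, if_neg (by omega), neg_zero]

lemma IsLeftClosed.mul_mem_degLE (F : IsLeftClosed p I u c) {y : W} (hy : y ∈ minReps cs I)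
    (b : ι) : stdBasis p y * c b ∈ degLE p 0 := by
  have := add_mem (degLE_mono p (by omega) (F.std_mul_sub_mem b y hy))
    (stdBasis_mem_degLE p (y * u b))
  rwa [sub_add_cancel] at this

/-- If the Kazhdan-Lusztig elements with small index are known, then every element of `indSpan` is
congruent to a bar-invariant one modulo coefficients of negative degree. -/
lemma IsLeftClosed.exists_bar_eq (F : IsLeftClosed p I u c) {m : ℕ}
    (hC : ∀ y ∈ minReps cs I, ∀ b, cs.length y < m →
      ∃ C, IsKL p (y * u b) C ∧ C - stdBasis p y * c b ∈ indSpan p I c (cs.length y))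
    {h : Hecke p} (hh : h ∈ indSpan p I c m) :
    ∃ g ∈ indSpan p I c m, bar p g = g ∧ h - g ∈ degLE p (-1) := by
  induction m generalizing h with
  | zero =>
    have : h = 0 := by
      rw [indSpan] at hh
      simpa using hh
    exact ⟨0, zero_mem _, bar_zero p, by simp [this]⟩
  | succ m ih =>
    have ih' : ∀ {h}, h ∈ indSpan p I c m →
        ∃ g ∈ indSpan p I c m, bar p g = g ∧ h - g ∈ degLE p (-1) :=
      fun {h} hh ↦ ih (fun y hy b hl ↦ hC y hy b (by omega)) hh
    suffices H : ∀ a : ℤ[T;T⁻¹], ∃ g ∈ indSpan p I c (m + 1),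
        bar p g = g ∧ a • h - g ∈ degLE p (-1) by
      simpa using H 1
    induction hh using Submodule.span_induction with
    | zero => exact fun a ↦ ⟨0, zero_mem _, bar_zero p, by simp⟩
    | add x y _ _ hx hy =>
      intro a
      obtain ⟨g, h1, h2, h3⟩ := hx a
      obtain ⟨g', h4, h5, h6⟩ := hy a
      refine ⟨g + g', add_mem h1 h4, by rw [bar_add, h2, h5], ?_⟩
      convert add_mem h3 h6 using 1
      module
    | smul b x _ hx => intro a; rw [smul_smul]; exact hx (a * b)
    | mem x hx =>
      intro a
      obtain ⟨y, hy, b, hl, rfl⟩ := hx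
      obtain ⟨γ, h1, h2⟩ := exists_invert_eq a
      obtain ⟨C, h3, h4⟩ := hC y hy b hl
      rw [isKL_iff] at h3
      -- replacing `a T_y c_b` by the bar-invariant `γ C'_{y u_b}` costs a term in the smaller span
      obtain ⟨g, h5, h6, h7⟩ := ih'
        (Submodule.smul_mem _ (-γ) (indSpan_mono p (Nat.le_of_lt_succ hl) h4))
      have h8 : C ∈ indSpan p I c (m + 1) := by
        have := add_mem (indSpan_mono p (by omega : cs.length y ≤ m + 1) h4)
          (mul_mem_indSpan p hy b hl)
        rwa [sub_add_cancel] at this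
      refine ⟨γ • C + g, add_mem (Submodule.smul_mem _ _ h8) (indSpan_mono p m.le_succ h5),
        by rw [bar_add, bar_smul, h1, h3.1, h6], ?_⟩
      have h9 : (a - γ) • (stdBasis p y * c b) ∈ degLE p (-1) :=
        smul_mem_degLE p h2 (F.mul_mem_degLE p hy b)
      convert add_mem h9 h7 using 1
      module

/-- The elements of the Kazhdan-Lusztig basis indexed by `X_I · {u_b}` exist, and the transition
matrix from the elements `T_y c_b` is unitriangular with respect to `ℓ(y)`. -/
theorem IsLeftClosed.exists_isKL (F : IsLeftClosed p I u c) {y : W} (hy : y ∈ minReps cs I)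
    (b : ι) : ∃ C, IsKL p (y * u b) C ∧ C - stdBasis p y * c b ∈ indSpan p I c (cs.length y) := by
  induction hn : cs.length y using Nat.strong_induction_on generalizing y b with
  | _ n ih =>
    subst hn
    by_cases hy1 : y = 1
    · subst hy1
      refine ⟨c b, (isKL_iff p).2 ⟨F.bar_eq b, ?_⟩, ?_⟩
      · simpa [← one_def] using F.std_mul_sub_mem b 1 hy
      · rw [← one_def, one_mul, sub_self]; exact zero_mem _
    · obtain ⟨r, hr⟩ := cs.exists_leftDescent_of_ne_one hy1
      have hlen := cs.isLeftDescent_iff.1 hr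
      have hy' := simple_mul_mem_minReps cs hy hr
      rw [isLeftDescent_iff_not_isLeftDescent_mul] at hr
      have e := stdBasis_simple_mul_of_lt p hr
      rw [simple_mul_simple_cancel_left] at e
      obtain ⟨D, hD, hD'⟩ := ih _ (by omega) hy' b rfl
      rw [isKL_iff] at hD
      -- `C'_r C'_{r y u_b}` has the right leading term; only a bar-invariant correction is missing
      have h1 : klSimple p r * D - stdBasis p y * c b ∈ indSpan p I c (cs.length y) := by
        have h2 := F.klSimple_mul_mem p r hD'
        have h3 : stdBasis p (cs.simple r * y) * c b ∈ indSpan p I c (cs.length y) :=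
          mul_mem_indSpan p hy' b (by omega)
        rw [hlen] at h2
        convert add_mem h2 (Submodule.smul_mem _ (𝐯 (-p.wt r)) h3) using 1
        rw [mul_sub, klSimple_mul p r (_ * _), ← mul_assoc, e]
        module
      obtain ⟨g, hg, hbar, hdeg⟩ := F.exists_bar_eq p
        (fun z hz b' hl ↦ ih _ hl hz b' rfl) h1
      refine ⟨klSimple p r * D - g, (isKL_iff p).2 ⟨?_, ?_⟩, ?_⟩
      · rw [bar_sub, bar_klSimple_mul, hD.1, hbar]
      · convert add_mem hdeg (F.std_mul_sub_mem b y hy) using 1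
        abel
      · convert sub_mem h1 hg using 1
        abel

variable (cs) in
lemma mem_minReps_empty (w : W) : w ∈ minReps cs ∅ := fun _ h ↦ h.elim

/-- Existence of the Kazhdan-Lusztig basis. -/
theorem isKL_klElt (w : W) : IsKL p w (klElt p w) := by
  have F : IsLeftClosed p ∅ (fun _ : Unit ↦ 1) (fun _ ↦ 1) :=
    ⟨fun _ ↦ bar_one p, fun _ y _ ↦ by simp, fun _ _ h ↦ h.elim⟩
  obtain ⟨C, hC, -⟩ := F.exists_isKL p (mem_minReps_empty cs w) ()
  rw [mul_one] at hC
  rwa [hC.klElt_eq]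

lemma linearIndependent_klElt : LinearIndependent ℤ[T;T⁻¹] (klElt p) :=
  linearIndependent_of_sub_mem_degLE p fun w ↦ ((isKL_iff p).1 (isKL_klElt p w)).2

lemma klElt_simple {i : B} (hi : 0 < p.wt i) : klElt p (cs.simple i) = klSimple p i := by
  refine IsKL.klElt_eq p ((isKL_iff p).2 ⟨bar_klSimple p i, ?_⟩)
  rw [klSimple, add_sub_cancel_left, one_def]
  exact T_smul_mem_degLE p (stdBasis_mem_degLE p 1) (by omega)

lemma IsLeftClosed.indSpan_le (F : IsLeftClosed p I u c) (n : ℕ) : indSpan p I c n ≤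
    Submodule.span _ (klElt p '' {w | ∃ y ∈ minReps cs I, ∃ b, w = y * u b}) := by
  induction n using Nat.strong_induction_on with
  | _ n ih =>
    rw [indSpan, Submodule.span_le]
    rintro _ ⟨y, hy, b, hl, rfl⟩
    obtain ⟨C, hC, hC'⟩ := F.exists_isKL p hy b
    have h1 : C ∈ Submodule.span ℤ[T;T⁻¹]
        (klElt p '' {w | ∃ y ∈ minReps cs I, ∃ b, w = y * u b}) :=
      Submodule.subset_span ⟨_, ⟨y, hy, b, rfl⟩, hC.klElt_eq⟩
    have := sub_mem h1 (ih _ hl hC')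
    rwa [sub_sub_cancel] at this

/-- The relation `←_L` preserves the set `X_I · {u_b}`, because the `C'_w` with `w` in this set span
a left ideal. -/
theorem IsLeftClosed.leftArrow (F : IsLeftClosed p I u c) (hpos : ∀ i, 0 < p.wt i) {y : W}
    (hy : y ∈ minReps cs I) (b : ι) {z : W} (hz : LeftArrow p z (y * u b)) :
    ∃ y' ∈ minReps cs I, ∃ b', z = y' * u b' := by
  obtain ⟨i, h, e, hz⟩ := hz
  obtain ⟨C, hC, hC'⟩ := F.exists_isKL p hy b
  have h1 : C ∈ indSpan p I c (cs.length y + 1) := by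
    have := add_mem (indSpan_mono p (by omega : cs.length y ≤ cs.length y + 1) hC')
      (mul_mem_indSpan p hy b (by omega))
    rwa [sub_add_cancel] at this
  rw [hC.klElt_eq, klElt_simple p (hpos i)] at e
  have h2 := F.indSpan_le p _ (F.klSimple_mul_mem p i h1)
  rw [e, Finsupp.mem_span_image_iff_linearCombination] at h2
  obtain ⟨f, hf, hf'⟩ := h2
  have : f = h := (linearIndependent_klElt p) hf'
  subst this
  exact hf (Finsupp.mem_support_iff.2 hz)

end Induction

section DihedralAlgebra

/-! ### Explicit bar-invariant elements for two simple reflections -/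

variable {B W : Type*} [Group W] {M : CoxeterMatrix B} {cs : CoxeterSystem M W} (p : Weights cs)
variable (i j : B)

lemma T_mul_T_neg (n : ℤ) : 𝐯 n * 𝐯 (-n) = 1 := by
  rw [← LaurentPolynomial.T_add, add_neg_cancel, LaurentPolynomial.T_zero]

/-- The element `(T_i T_j) ^ k C'_i`. -/
def dihStd : ℕ → Hecke p
  | 0 => klSimple p i
  | k + 1 => stdBasis p (cs.simple i) * (stdBasis p (cs.simple j) * dihStd k)

/-- The sum of all alternating products of length at most `2 k + 1` in `T_i`, `T_j` with last factor
`C'_i`, each with the power of `v` given by the weight of the missing factors. -/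
def dihOddSum : ℕ → Hecke p
  | 0 => klSimple p i
  | k + 1 => dihStd p i j (k + 1) +
      𝐯 (-p.wt i) • (stdBasis p (cs.simple j) * dihStd p i j k) +
      𝐯 (-p.wt i - p.wt j) • dihOddSum k

/-- The sum of all alternating products of length at most `2 k` in `T_i`, `T_j` with last factor
`C'_i`, each with the power of `v` given by the weight of the missing factors. -/
def dihEven : ℕ → Hecke p
  | 0 => 0
  | k + 1 => stdBasis p (cs.simple j) * dihStd p i j k + 𝐯 (-p.wt j) • dihStd p i j k +
      𝐯 (-p.wt i - p.wt j) • dihEven k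

/-- The alternating sum of the `dihOddSum` which is bar-invariant if `p_j < p_i`. -/
def dihOddAlt : ℕ → Hecke p
  | 0 => klSimple p i
  | k + 1 => dihOddSum p i j (k + 1) - 𝐯 (p.wt j - p.wt i) • dihOddAlt k

open Classical in
/-- The bar-invariant element with leading term the alternating product of length `2 k + 1` that
ends in `i`; the bar-invariant element of length `2 k` is `dihEven`. -/
def dihOdd (k : ℕ) : Hecke p :=
  if p.wt i < p.wt j then
    match k with
    | 0 => klSimple p i
    | k + 1 => klSimple p i * dihEven p i j (k + 1)
  else if p.wt j < p.wt i then dihOddAlt p i j k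
  else dihOddSum p i j k

lemma simple_mul_klSimple :
    stdBasis p (cs.simple i) * klSimple p i = 𝐯 (p.wt i) • klSimple p i := by
  have hx := T_mul_T_neg (p.wt i)
  rw [klSimple, mul_add, stdBasis_simple_sq, mul_smul_comm, mul_one, xi]
  linear_combination (norm := module) (-hx) • (1 : Hecke p)

lemma simple_mul_dihStd_succ (k : ℕ) :
    stdBasis p (cs.simple i) * dihStd p i j (k + 1) =
      stdBasis p (cs.simple j) * dihStd p i j k + (𝐯 (p.wt i) - 𝐯 (-p.wt i)) •
        dihStd p i j (k + 1) := by
  rw [dihStd, stdBasis_simple_mul_mul, xi]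

lemma simple_mul_dihOddSum (k : ℕ) :
    stdBasis p (cs.simple i) * dihOddSum p i j k = 𝐯 (p.wt i) • dihOddSum p i j k := by
  induction k with
  | zero => exact simple_mul_klSimple p i
  | succ k ih =>
    have hx := T_mul_T_neg (p.wt i)
    rw [dihOddSum, mul_add, mul_add, simple_mul_dihStd_succ, mul_smul_comm, mul_smul_comm, ih,
      ← dihStd]
    linear_combination (norm := module) (-hx) • (stdBasis p (cs.simple j) * dihStd p i j k)

lemma simple_mul_dihEven (k : ℕ) :
    stdBasis p (cs.simple j) * dihEven p i j k = 𝐯 (p.wt j) • dihEven p i j k := by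
  induction k with
  | zero => simp [dihEven]
  | succ k ih =>
    have hx := T_mul_T_neg (p.wt j)
    rw [dihEven, mul_add, mul_add, stdBasis_simple_mul_mul, mul_smul_comm, mul_smul_comm, ih, xi]
    linear_combination (norm := module) (-hx) • dihStd p i j k

lemma klSimple_mul_dihOddSum (k : ℕ) : klSimple p j * dihOddSum p i j k =
    dihEven p i j (k + 1) + 𝐯 (p.wt j - p.wt i) • dihEven p i j k := by
  induction k with
  | zero =>
    rw [klSimple_mul]
    simp [dihOddSum, dihEven, dihStd]
  | succ k ih =>
    have hx := T_mul_T_neg (p.wt j)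
    have e1 : 𝐯 (p.wt j - p.wt i) = 𝐯 (p.wt j) * 𝐯 (-p.wt i) := LaurentPolynomial.T_sub _ _
    have e2 : 𝐯 (-p.wt i - p.wt j) = 𝐯 (-p.wt i) * 𝐯 (-p.wt j) := LaurentPolynomial.T_sub _ _
    rw [dihOddSum, mul_add, mul_add, mul_smul_comm (𝐯 (-p.wt i - p.wt j)), ih,
      dihEven.eq_2 p i j (k + 1), dihEven.eq_2 p i j k, klSimple_mul, mul_smul_comm, klSimple_mul,
      stdBasis_simple_mul_mul, xi, e1, e2]
    linear_combination (norm := module) (-hx) • (𝐯 (-p.wt i) • dihStd p i j k)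

lemma klSimple_mul_dihEven (k : ℕ) : klSimple p i * dihEven p i j (k + 1) =
    dihOddSum p i j (k + 1) + 𝐯 (p.wt i - p.wt j) • dihOddSum p i j k := by
  have hx := T_mul_T_neg (p.wt i)
  have e1 : 𝐯 (p.wt i - p.wt j) = 𝐯 (p.wt i) * 𝐯 (-p.wt j) := LaurentPolynomial.T_sub _ _
  have e2 : 𝐯 (-p.wt i - p.wt j) = 𝐯 (-p.wt i) * 𝐯 (-p.wt j) := LaurentPolynomial.T_sub _ _
  induction k with
  | zero =>
    have h0 := simple_mul_klSimple p i
    rw [klSimple_mul]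
    simp only [dihEven, dihStd, dihOddSum, mul_add, mul_smul_comm, h0, smul_zero, add_zero, e1, e2]
    module
  | succ k ih =>
    rw [dihEven, mul_add, mul_add, mul_smul_comm (𝐯 (-p.wt i - p.wt j)), ih, mul_smul_comm,
      klSimple_mul, klSimple_mul, ← dihStd, simple_mul_dihStd_succ, dihOddSum.eq_2 p i j (k + 1),
      dihOddSum.eq_2 p i j k, e1, e2]
    linear_combination (norm := module) (-hx) •
      (𝐯 (-p.wt j) • (stdBasis p (cs.simple j) * dihStd p i j k))

lemma dihOdd_of_eq (h : p.wt i = p.wt j) (k : ℕ) : dihOdd p i j k = dihOddSum p i j k := by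
  simp [dihOdd, h]

lemma dihOdd_of_gt (h : p.wt j < p.wt i) (k : ℕ) : dihOdd p i j k = dihOddAlt p i j k := by
  simp [dihOdd, h, h.le]

lemma dihOdd_succ_of_lt (h : p.wt i < p.wt j) (k : ℕ) :
    dihOdd p i j (k + 1) = klSimple p i * dihEven p i j (k + 1) := by
  simp [dihOdd, h]

lemma dihOdd_zero : dihOdd p i j 0 = klSimple p i := by
  simp [dihOdd, dihOddAlt, dihOddSum]

lemma simple_mul_dihOdd (k : ℕ) :
    stdBasis p (cs.simple i) * dihOdd p i j k = 𝐯 (p.wt i) • dihOdd p i j k := by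
  rcases lt_trichotomy (p.wt i) (p.wt j) with h | h | h
  · cases k with
    | zero => rw [dihOdd_zero, simple_mul_klSimple]
    | succ k =>
      rw [dihOdd_succ_of_lt p i j h, klSimple_mul_dihEven, mul_add, mul_smul_comm,
        simple_mul_dihOddSum, simple_mul_dihOddSum]
      module
  · rw [dihOdd_of_eq p i j h, simple_mul_dihOddSum]
  · rw [dihOdd_of_gt p i j h]
    induction k with
    | zero => exact simple_mul_klSimple p i
    | succ k ih =>
      rw [dihOddAlt, mul_sub, mul_smul_comm, ih, simple_mul_dihOddSum]
      module

/-- The coefficient `v ^ (p_i - p_j) + v ^ (p_j - p_i)` in the multiplication rules. -/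
def zeta : ℤ[T;T⁻¹] := 𝐯 (p.wt i - p.wt j) + 𝐯 (p.wt j - p.wt i)

lemma zeta_ne_zero : zeta p i j ≠ 0 := by
  intro h
  have h1 := congrArg (fun a : ℤ[T;T⁻¹] ↦ a.coeff (p.wt i - p.wt j)) h
  simp only [zeta, AddMonoidAlgebra.coeff_add, Finsupp.add_apply, LaurentPolynomial.T_apply,
    AddMonoidAlgebra.coeff_zero, Finsupp.coe_zero, Pi.zero_apply, if_true] at h1
  split_ifs at h1 <;> omega

lemma invert_zeta : LaurentPolynomial.invert (zeta p i j) = zeta p i j := by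
  simp [zeta, add_comm]

/-! The multiplication rules: equal weights. -/

lemma klSimple_mul_dihOdd_of_eq (h : p.wt i = p.wt j) (k : ℕ) :
    klSimple p j * dihOdd p i j k = dihEven p i j (k + 1) + dihEven p i j k := by
  rw [dihOdd_of_eq p i j h, klSimple_mul_dihOddSum, h, sub_self, LaurentPolynomial.T_zero, one_smul]

lemma klSimple_mul_dihEven_of_eq (h : p.wt i = p.wt j) (k : ℕ) :
    klSimple p i * dihEven p i j (k + 1) = dihOdd p i j (k + 1) + dihOdd p i j k := by
  rw [dihOdd_of_eq p i j h, dihOdd_of_eq p i j h, klSimple_mul_dihEven, h, sub_self,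
    LaurentPolynomial.T_zero, one_smul]

/-! The multiplication rules: `p_i < p_j`. -/

lemma klSimple_mul_dihOdd_zero_of_lt :
    klSimple p j * dihOdd p i j 0 = dihEven p i j 1 := by
  have := klSimple_mul_dihOddSum p i j 0
  rw [dihEven.eq_1, smul_zero, add_zero] at this
  rw [dihOdd_zero, ← this, dihOddSum]

lemma klSimple_mul_dihOdd_succ_of_lt (h : p.wt i < p.wt j) (k : ℕ) :
    klSimple p j * dihOdd p i j (k + 1) =
      dihEven p i j (k + 2) + zeta p i j • dihEven p i j (k + 1) + dihEven p i j k := by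
  have hx : 𝐯 (p.wt i - p.wt j) * 𝐯 (p.wt j - p.wt i) = 1 := by
    rw [← LaurentPolynomial.T_add, sub_add_sub_cancel, sub_self, LaurentPolynomial.T_zero]
  rw [dihOdd_succ_of_lt p i j h, klSimple_mul_dihEven, mul_add, mul_smul_comm,
    klSimple_mul_dihOddSum, klSimple_mul_dihOddSum, zeta]
  linear_combination (norm := module) hx • dihEven p i j k

/-! The multiplication rules: `p_j < p_i`. -/

lemma klSimple_mul_dihOdd_of_gt (h : p.wt j < p.wt i) (k : ℕ) :
    klSimple p j * dihOdd p i j k = dihEven p i j (k + 1) := by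
  rw [dihOdd_of_gt p i j h]
  induction k with
  | zero =>
    have := klSimple_mul_dihOddSum p i j 0
    rw [dihEven.eq_1, smul_zero, add_zero] at this
    rw [← this, dihOddSum, dihOddAlt]
  | succ k ih =>
    rw [dihOddAlt, mul_sub, klSimple_mul_dihOddSum, mul_smul_comm, ih]
    module

lemma klSimple_mul_dihEven_one_of_gt (h : p.wt j < p.wt i) :
    klSimple p i * dihEven p i j 1 = dihOdd p i j 1 + zeta p i j • dihOdd p i j 0 := by
  have e : dihOddSum p i j 1 = dihOddAlt p i j 1 +
      𝐯 (p.wt j - p.wt i) • dihOddAlt p i j 0 := by rw [dihOddAlt.eq_2]; abel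
  have e0 : dihOddSum p i j 0 = dihOddAlt p i j 0 := by rw [dihOddSum, dihOddAlt]
  rw [klSimple_mul_dihEven, dihOdd_of_gt p i j h, dihOdd_of_gt p i j h, e, e0, zeta]
  module

lemma klSimple_mul_dihEven_succ_of_gt (h : p.wt j < p.wt i) (k : ℕ) :
    klSimple p i * dihEven p i j (k + 2) =
      dihOdd p i j (k + 2) + zeta p i j • dihOdd p i j (k + 1) + dihOdd p i j k := by
  have hx : 𝐯 (p.wt i - p.wt j) * 𝐯 (p.wt j - p.wt i) = 1 := by
    rw [← LaurentPolynomial.T_add, sub_add_sub_cancel, sub_self, LaurentPolynomial.T_zero]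
  rw [klSimple_mul_dihEven, dihOdd_of_gt p i j h, dihOdd_of_gt p i j h, dihOdd_of_gt p i j h,
    dihOddAlt.eq_2 p i j (k + 1), dihOddAlt.eq_2 p i j k, zeta]
  have e : dihOddSum p i j (k + 1) = dihOddAlt p i j (k + 1) +
      𝐯 (p.wt j - p.wt i) • dihOddAlt p i j k := by rw [dihOddAlt]; abel
  rw [e]
  linear_combination (norm := module) hx • dihOddAlt p i j k

lemma bar_eq_of_klSimple_mul_eq {i : B} {h x y : Hecke p} (e : klSimple p i * h = x + y)
    (hh : bar p h = h) (hy : bar p y = y) : bar p x = x := by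
  rw [eq_sub_of_add_eq e.symm, bar_sub, bar_klSimple_mul, hh, hy]

lemma bar_zeta_smul {h : Hecke p} (hh : bar p h = h) :
    bar p (zeta p i j • h) = zeta p i j • h := by
  rw [bar_smul, invert_zeta, hh]

lemma bar_dihEven_dihOdd (k : ℕ) :
    bar p (dihEven p i j k) = dihEven p i j k ∧ bar p (dihOdd p i j k) = dihOdd p i j k ∧
      bar p (dihEven p i j (k + 1)) = dihEven p i j (k + 1) := by
  induction k using Nat.strong_induction_on with
  | _ k ih =>
  have hE : bar p (dihEven p i j k) = dihEven p i j k := by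
    cases k with
    | zero => rw [dihEven, bar_zero]
    | succ k => exact (ih k (by omega)).2.2
  have hO : bar p (dihOdd p i j k) = dihOdd p i j k := by
    cases k with
    | zero => rw [dihOdd_zero, bar_klSimple]
    | succ k =>
      have hk := (ih k (by omega)).2.1
      rcases lt_trichotomy (p.wt i) (p.wt j) with h | h | h
      · rw [dihOdd_succ_of_lt p i j h, bar_klSimple_mul, hE]
      · exact bar_eq_of_klSimple_mul_eq p (klSimple_mul_dihEven_of_eq p i j h k) hE hk
      · cases k with
        | zero =>
          exact bar_eq_of_klSimple_mul_eq p (klSimple_mul_dihEven_one_of_gt p i j h) hE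
            (bar_zeta_smul p i j hk)
        | succ k =>
          refine bar_eq_of_klSimple_mul_eq p
            ((klSimple_mul_dihEven_succ_of_gt p i j h k).trans (add_assoc _ _ _)) hE ?_
          rw [bar_add, bar_zeta_smul p i j hk, (ih k (by omega)).2.1]
  refine ⟨hE, hO, ?_⟩
  rcases lt_trichotomy (p.wt i) (p.wt j) with h | h | h
  · cases k with
    | zero => rw [← klSimple_mul_dihOdd_zero_of_lt, bar_klSimple_mul, hO]
    | succ k =>
      refine bar_eq_of_klSimple_mul_eq p
        ((klSimple_mul_dihOdd_succ_of_lt p i j h k).trans (add_assoc _ _ _)) hO ?_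
      rw [bar_add, bar_zeta_smul p i j hE, (ih k (by omega)).1]
  · exact bar_eq_of_klSimple_mul_eq p (klSimple_mul_dihOdd_of_eq p i j h k) hO hE
  · rw [← klSimple_mul_dihOdd_of_gt p i j h, bar_klSimple_mul, hO]

lemma bar_dihEven (k : ℕ) : bar p (dihEven p i j k) = dihEven p i j k :=
  (bar_dihEven_dihOdd p i j k).1

lemma bar_dihOdd (k : ℕ) : bar p (dihOdd p i j k) = dihOdd p i j k :=
  (bar_dihEven_dihOdd p i j k).2.1

/-! The leading terms of the bar-invariant elements, after multiplication by some `z` from the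
left. -/

variable {i j}

lemma mul_dihOddSum_dihEven_mem (hpos : ∀ i, 0 < p.wt i) (z : Hecke p) {k : ℕ}
    (hf : ∀ l ≤ k, z * dihStd p i j l ∈ degLE p 0)
    (hg : ∀ l < k, z * (stdBasis p (cs.simple j) * dihStd p i j l) ∈ degLE p 0) :
    z * dihOddSum p i j k - z * dihStd p i j k ∈ degLE p (-1) ∧
      z * dihEven p i j k ∈ degLE p 0 ∧
      z * dihEven p i j (k + 1) - z * (stdBasis p (cs.simple j) * dihStd p i j k) ∈
        degLE p (-1) := by
  have hi := hpos i
  have hj := hpos j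
  induction k with
  | zero =>
    refine ⟨?_, ?_, ?_⟩
    · simp [dihOddSum, dihStd]
    · simp [dihEven]
    · rw [dihEven, dihEven, smul_zero, add_zero, mul_add, add_sub_cancel_left, mul_smul_comm]
      exact T_smul_mem_degLE p (hf 0 le_rfl) (by omega)
  | succ k ih =>
    obtain ⟨h1, h2, h3⟩ := ih (fun l hl ↦ hf l (by omega)) (fun l hl ↦ hg l (by omega))
    have h4 : z * dihOddSum p i j k ∈ degLE p 0 := by
      have := add_mem (degLE_mono p (by omega) h1) (hf k (by omega))
      rwa [sub_add_cancel] at this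
    have h5 : z * dihEven p i j (k + 1) ∈ degLE p 0 := by
      have := add_mem (degLE_mono p (by omega) h3) (hg k (by omega))
      rwa [sub_add_cancel] at this
    refine ⟨?_, h5, ?_⟩
    · convert add_mem (T_smul_mem_degLE p (n := -p.wt i) (e := -1) (hg k (by omega)) (by omega))
        (T_smul_mem_degLE p (n := -p.wt i - p.wt j) h4 (by omega)) using 1
      rw [dihOddSum, mul_add, mul_add, mul_smul_comm, mul_smul_comm]
      abel
    · convert add_mem (T_smul_mem_degLE p (n := -p.wt j) (e := -1) (hf (k + 1) le_rfl) (by omega))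
        (T_smul_mem_degLE p (n := -p.wt i - p.wt j) h5 (by omega)) using 1
      rw [dihEven, mul_add, mul_add, mul_smul_comm, mul_smul_comm]
      abel

lemma mul_dihOdd_sub_mem (hpos : ∀ i, 0 < p.wt i) (z : Hecke p) {k : ℕ}
    (hf : ∀ l ≤ k, z * dihStd p i j l ∈ degLE p 0)
    (hg : ∀ l < k, z * (stdBasis p (cs.simple j) * dihStd p i j l) ∈ degLE p 0) :
    z * dihOdd p i j k - z * dihStd p i j k ∈ degLE p (-1) := by
  have hS : ∀ l ≤ k, z * dihOddSum p i j l - z * dihStd p i j l ∈ degLE p (-1) := fun l hl ↦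
    (mul_dihOddSum_dihEven_mem p hpos z (fun a ha ↦ hf a (by omega))
      (fun a ha ↦ hg a (by omega))).1
  have hS' : ∀ l ≤ k, z * dihOddSum p i j l ∈ degLE p 0 := by
    intro l hl
    have := add_mem (degLE_mono p (by omega) (hS l hl)) (hf l hl)
    rwa [sub_add_cancel] at this
  rcases lt_trichotomy (p.wt i) (p.wt j) with h | h | h
  · cases k with
    | zero => simp [dihOdd_zero, dihStd]
    | succ k =>
      rw [dihOdd_succ_of_lt p i j h, klSimple_mul_dihEven]
      convert add_mem (hS (k + 1) le_rfl) (T_smul_mem_degLE p (n := p.wt i - p.wt j)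
        (hS' k (by omega)) (by omega)) using 1
      rw [mul_add, mul_smul_comm]
      abel
  · rw [dihOdd_of_eq p i j h]
    exact hS k le_rfl
  · rw [dihOdd_of_gt p i j h]
    have key : ∀ l ≤ k, z * dihOddAlt p i j l - z * dihStd p i j l ∈ degLE p (-1) := by
      intro l
      induction l with
      | zero => intro _; simp [dihOddAlt, dihStd]
      | succ l ih =>
        intro hl
        have h1 : z * dihOddAlt p i j l ∈ degLE p 0 := by
          have := add_mem (degLE_mono p (by omega) (ih (by omega))) (hf l (by omega))
          rwa [sub_add_cancel] at this
        convert sub_mem (hS (l + 1) hl) (T_smul_mem_degLE p (n := p.wt j - p.wt i) h1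
          (by omega)) using 1
        rw [dihOddAlt, mul_sub, mul_smul_comm]
        abel
    exact key k le_rfl

end DihedralAlgebra

section DihedralWords

/-! ### Alternating words in two simple reflections -/

variable {B W : Type*} [Group W] {M : CoxeterMatrix B} (cs : CoxeterSystem M W) (i j : B)

/-- The product of the alternating word of length `n` in `i` and `j` that ends in `i`. -/
def altElt (n : ℕ) : W := cs.wordProd (alternatingWord j i n)

/-- The condition `n ≤ m`, where `m` is the order of `s_i s_j`; if this order is infinite,
`orderOf` is `0` and there is no condition on `n`. -/
def InRange (n : ℕ) : Prop :=
  orderOf (cs.simple i * cs.simple j) = 0 ∨ n ≤ orderOf (cs.simple i * cs.simple j)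

@[simp] lemma altElt_zero : altElt cs i j 0 = 1 := by simp [altElt, alternatingWord]

lemma altElt_succ (n : ℕ) : altElt cs i j (n + 1) = altElt cs j i n * cs.simple i := by
  rw [altElt, alternatingWord_succ, wordProd_concat, altElt]

lemma altElt_succ_even {n : ℕ} (hn : Even n) :
    altElt cs i j (n + 1) = cs.simple i * altElt cs i j n := by
  rw [altElt, alternatingWord_succ', wordProd_cons, if_pos hn, altElt]

lemma altElt_succ_odd {n : ℕ} (hn : ¬ Even n) :
    altElt cs i j (n + 1) = cs.simple j * altElt cs i j n := by
  rw [altElt, alternatingWord_succ', wordProd_cons, if_neg hn, altElt]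

@[simp] lemma altElt_one : altElt cs i j 1 = cs.simple i := by simp [altElt_succ]

lemma altElt_succ_mul (n : ℕ) : altElt cs i j (n + 1) * cs.simple i = altElt cs j i n := by
  rw [altElt_succ, simple_mul_simple_cancel_right]

lemma length_altElt_le (n : ℕ) : cs.length (altElt cs i j n) ≤ n := by
  refine (cs.length_wordProd_le _).trans ?_
  rw [length_alternatingWord]

lemma length_altElt_mod_two (n : ℕ) : cs.length (altElt cs i j n) % 2 = n % 2 := by
  induction n generalizing i j with
  | zero => simp
  | succ n ih =>
    have := ih j i
    rw [altElt_succ]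
    rcases cs.length_mul_simple (altElt cs j i n) i with h | h <;> omega

lemma altElt_mem_parabolic (n : ℕ) : altElt cs i j n ∈ parabolic cs {i, j} := by
  induction n generalizing i j with
  | zero => simp
  | succ n ih =>
    rw [altElt_succ, Set.pair_comm]
    exact mul_mem (ih j i) (simple_mem_parabolic cs (by simp))

/-- In an equality of two alternating products with different last factors, `k` factors can be moved
from one side to the other; the parity of `k` decides about the new last factors. -/
lemma altElt_shift {i j : B} {n k l : ℕ} (h : altElt cs i j (n + k) = altElt cs j i l) :
    altElt cs i j n = altElt cs j i (l + k) ∨ altElt cs j i n = altElt cs i j (l + k) := by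
  induction k generalizing i j l with
  | zero => exact .inl h
  | succ k ih =>
    have h1 : altElt cs i j (n + (k + 1)) * cs.simple i = altElt cs j i l * cs.simple i := by
      rw [h]
    rw [← add_assoc, altElt_succ_mul, ← altElt_succ] at h1
    have := ih h1
    rw [show l + (k + 1) = l + 1 + k by ring]
    exact this.symm

lemma altElt_add_two_mul (l d : ℕ) : altElt cs i j (l + 2 * d) =
    (if Even l then cs.simple j * cs.simple i else cs.simple i * cs.simple j) ^ d *
      altElt cs i j l := by
  induction d with
  | zero => simp
  | succ d ih =>
    rw [pow_succ', mul_assoc, ← ih, show l + 2 * (d + 1) = l + 2 * d + 1 + 1 by ring]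
    by_cases hl : Even l
    · rw [if_pos hl, altElt_succ_odd _ _ _ (by simpa [Nat.even_add_one, Nat.even_add] using hl),
        altElt_succ_even _ _ _ (by simpa [Nat.even_add] using hl), mul_assoc]
    · rw [if_neg hl, altElt_succ_even _ _ _ (by simpa [Nat.even_add_one, Nat.even_add] using hl),
        altElt_succ_odd _ _ _ (by simpa [Nat.even_add] using hl), mul_assoc]

lemma orderOf_simple_mul_comm : orderOf (cs.simple j * cs.simple i) =
    orderOf (cs.simple i * cs.simple j) := by
  rw [← orderOf_inv, mul_inv_rev, inv_simple, inv_simple]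

lemma orderOf_dvd_of_altElt_eq {l d : ℕ} (h : altElt cs i j (l + 2 * d) = altElt cs i j l) :
    orderOf (cs.simple i * cs.simple j) ∣ d := by
  rw [altElt_add_two_mul, mul_eq_right] at h
  split_ifs at h
  · rw [← orderOf_simple_mul_comm]; exact orderOf_dvd_of_pow_eq_one h
  · exact orderOf_dvd_of_pow_eq_one h

variable {cs i j}

lemma InRange.symm {n : ℕ} (h : InRange cs i j n) : InRange cs j i n := by
  rwa [InRange, orderOf_simple_mul_comm]

lemma InRange.mono {m n : ℕ} (h : InRange cs i j n) (hmn : m ≤ n) : InRange cs i j m := by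
  unfold InRange at *; omega

lemma inRange_one : InRange cs i j 1 := by unfold InRange; omega

lemma eq_orderOf_of_not_inRange_succ {n : ℕ} (h : InRange cs i j n)
    (h' : ¬ InRange cs i j (n + 1)) :
    n = orderOf (cs.simple i * cs.simple j) := by
  unfold InRange at *; omega

variable (cs i j)

/-- An element of the parabolic subgroup generated by two simple reflections is an alternating
product with as many factors as its length. -/
lemma exists_eq_altElt {u : W} (hu : u ∈ parabolic cs {i, j}) :
    u = altElt cs i j (cs.length u) ∨ u = altElt cs j i (cs.length u) := by
  obtain ⟨ω, hωI, hω, rfl⟩ := exists_isReduced_of_mem_parabolic cs hu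
  clear hu
  rw [hω.eq]
  induction ω using List.reverseRecOn with
  | nil => simp
  | append_singleton ω k ih =>
    have hω' : cs.IsReduced ω := by simpa using hω.take ω.length
    have h1 := ih (fun b hb ↦ hωI b (List.mem_append_left _ hb)) hω'
    have hlen : cs.length (cs.wordProd ω * cs.simple k) = ω.length + 1 := by
      have := hω.eq
      rwa [wordProd_append, wordProd_singleton, List.length_append, List.length_singleton] at this
    rw [wordProd_append, wordProd_singleton, List.length_append, List.length_singleton]
    have key : ∀ a b : B, cs.wordProd ω = altElt cs a b ω.length → k = b ∨ k = a →
        cs.wordProd ω * cs.simple k = altElt cs b a (ω.length + 1) ∨ ω.length = 0 := by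
      rintro a b e (rfl | rfl)
      · rw [altElt_succ, ← e]; exact .inl rfl
      · right
        by_contra h0
        obtain ⟨n, hn⟩ := Nat.exists_eq_succ_of_ne_zero h0
        rw [e, hn, Nat.succ_eq_add_one, altElt_succ_mul] at hlen
        have := length_altElt_le cs b k n
        omega
    have hk : k = i ∨ k = j := by simpa using hωI k (by simp)
    have h0 : ω.length = 0 → cs.wordProd ω * cs.simple k = altElt cs i j (ω.length + 1) ∨
        cs.wordProd ω * cs.simple k = altElt cs j i (ω.length + 1) := by
      intro h0
      rw [List.length_eq_zero_iff.1 h0]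
      rcases hk with rfl | rfl <;> simp
    rcases h1 with h1 | h1
    · rcases key i j h1 hk.symm with h | h
      · exact .inr h
      · exact h0 h
    · rcases key j i h1 hk with h | h
      · exact .inl h
      · exact h0 h

variable {cs i j}

/-- If a product of `n ≤ m` alternating factors were shorter than `n`, it would be a shorter
alternating product, and cancelling would give a power of `s_i s_j` with exponent between `0` and
`m` that is trivial. -/
lemma length_altElt {n : ℕ} (hn : InRange cs i j n) : cs.length (altElt cs i j n) = n := by
  have hle := length_altElt_le cs i j n
  have hmod := length_altElt_mod_two cs i j n
  by_contra hne
  set l := cs.length (altElt cs i j n) with hl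
  have hdvd : ∀ d, d < n → orderOf (cs.simple i * cs.simple j) ∣ d → d = 0 := by
    rintro d hd h
    rcases hn with h0 | hn
    · rw [h0] at h; exact Nat.eq_zero_of_zero_dvd h
    · exact Nat.eq_zero_of_dvd_of_lt h (by omega)
  rcases exists_eq_altElt cs i j (altElt_mem_parabolic cs i j n) with h | h
  · rw [← hl] at h
    have h2 : altElt cs i j (l + 2 * ((n - l) / 2)) = altElt cs i j l := by
      rw [← h]; congr 1; omega
    have := hdvd _ (by omega) (orderOf_dvd_of_altElt_eq cs i j h2)
    omega
  · rw [← hl] at h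
    have h2 : altElt cs i j (0 + n) = altElt cs j i l := by rw [zero_add]; exact h
    have h3 := altElt_shift cs h2
    have e : l + n = 0 + 2 * ((l + n) / 2) := by omega
    have hdvd' : orderOf (cs.simple i * cs.simple j) ∣ (l + n) / 2 := by
      rcases h3 with h3 | h3
      · rw [← orderOf_simple_mul_comm]
        apply orderOf_dvd_of_altElt_eq cs j i (l := 0)
        rw [← e, ← h3]; simp
      · apply orderOf_dvd_of_altElt_eq cs i j (l := 0)
        rw [← e, ← h3]; simp
    have := hdvd _ (by omega) hdvd'
    omega

variable (cs i j) in
/-- The two alternating products of length the order of `s_i s_j` coincide. -/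
lemma altElt_orderOf : altElt cs i j (orderOf (cs.simple i * cs.simple j)) =
    altElt cs j i (orderOf (cs.simple i * cs.simple j)) := by
  set m := orderOf (cs.simple i * cs.simple j) with hm
  have h : altElt cs i j (m + m) = altElt cs j i 0 := by
    have := altElt_add_two_mul cs i j 0 m
    rw [if_pos Even.zero, zero_add, two_mul] at this
    rw [this, hm, ← orderOf_simple_mul_comm, pow_orderOf_eq_one]
    simp
  rcases altElt_shift cs h with h | h
  · rwa [zero_add] at h
  · rw [zero_add] at h; exact h.symm

lemma inRange_length {u : W} (hu : u ∈ parabolic cs {i, j}) : InRange cs i j (cs.length u) := by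
  by_contra hn
  rw [InRange, not_or, not_le] at hn
  obtain ⟨k, hk⟩ := Nat.exists_eq_add_of_le hn.2
  -- a longer alternating product starts with the two equal products and can be shortened
  have key : ∀ a b : B, orderOf (cs.simple a * cs.simple b) =
      orderOf (cs.simple i * cs.simple j) → u = altElt cs a b (cs.length u) → False := by
    intro a b hab e
    have hlt : ∀ k a b, orderOf (cs.simple a * cs.simple b) =
        orderOf (cs.simple i * cs.simple j) → cs.length (altElt cs a b
        (orderOf (cs.simple i * cs.simple j) + 1 + k)) <
        orderOf (cs.simple i * cs.simple j) + 1 + k := by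
      intro k
      induction k with
      | zero =>
        intro a b hab
        have h1 := altElt_orderOf cs a b
        rw [hab] at h1
        obtain ⟨d, hd⟩ := Nat.exists_eq_succ_of_ne_zero hn.1
        rw [add_zero, altElt_succ, ← h1, hd, Nat.succ_eq_add_one, altElt_succ_mul]
        have := length_altElt_le cs b a d
        omega
      | succ k ih =>
        intro a b hab
        have := ih b a (by rw [orderOf_simple_mul_comm, hab])
        rw [← add_assoc, altElt_succ]
        rcases cs.length_mul_simple (altElt cs b a
          (orderOf (cs.simple i * cs.simple j) + 1 + k)) a with h | h <;> omega
    have := hlt k a b hab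
    rw [show orderOf (cs.simple i * cs.simple j) + 1 + k = cs.length u by omega, ← e] at this
    omega
  rcases exists_eq_altElt cs i j hu with h | h
  · exact key i j rfl h
  · exact key j i (orderOf_simple_mul_comm cs i j) h

lemma isRightDescent_altElt_succ {n : ℕ} (hn : InRange cs i j (n + 1)) :
    cs.IsRightDescent (altElt cs i j (n + 1)) i := by
  rw [CoxeterSystem.IsRightDescent, altElt_succ_mul, length_altElt hn]
  exact Nat.lt_succ_of_le (length_altElt_le cs j i n)

lemma not_isRightDescent_altElt {n : ℕ} (hn : InRange cs i j (n + 1)) :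
    ¬ cs.IsRightDescent (altElt cs i j n) j := by
  rw [CoxeterSystem.IsRightDescent, ← altElt_succ, length_altElt hn.symm,
    length_altElt (hn.mono n.le_succ)]
  omega

/-! The right multiplication of alternating products by `s_i s_j s_i`. -/

lemma length_altElt_mul_of_two_le {n : ℕ} (h2 : 2 ≤ n) (hn : InRange cs i j n) :
    cs.length (altElt cs i j n * (cs.simple i * cs.simple j * cs.simple i)) <
      cs.length (altElt cs i j n) := by
  rw [length_altElt hn]
  obtain ⟨k, rfl⟩ := Nat.exists_eq_add_of_le' h2
  rw [← mul_assoc, ← mul_assoc, altElt_succ_mul, altElt_succ_mul]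
  cases k with
  | zero => simp
  | succ k =>
    rw [altElt_succ_mul]
    have := length_altElt_le cs j i k
    omega

lemma not_length_simple_mul_lt (hn : InRange cs i j 2) :
    ¬ cs.length (altElt cs i j 1 * (cs.simple i * cs.simple j * cs.simple i)) <
      cs.length (altElt cs i j 1) := by
  rw [length_altElt inRange_one, ← mul_assoc, ← mul_assoc, altElt_succ_mul, altElt_zero, one_mul,
    ← altElt_one cs j i, ← altElt_succ, length_altElt hn]
  omega

lemma not_length_altElt_mul_lt {n : ℕ} (hn : InRange cs i j (n + 2)) :
    ¬ cs.length (altElt cs j i n * (cs.simple i * cs.simple j * cs.simple i)) <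
      cs.length (altElt cs j i n) := by
  rw [length_altElt (hn.symm.mono (by omega)), ← mul_assoc, ← mul_assoc, ← altElt_succ,
    ← altElt_succ]
  have h : cs.length (altElt cs j i (n + 1 + 1)) = n + 2 := length_altElt hn.symm
  rcases cs.length_mul_simple (altElt cs j i (n + 1 + 1)) i with h' | h' <;> omega

lemma length_altElt_mul_of_eq_orderOf {n : ℕ}
    (hn : n + 2 = orderOf (cs.simple i * cs.simple j)) :
    cs.length (altElt cs j i (n + 1) * (cs.simple i * cs.simple j * cs.simple i)) <
      cs.length (altElt cs j i (n + 1)) := by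
  have h1 := altElt_orderOf cs i j
  rw [← hn] at h1
  rw [length_altElt (.inr (by rw [orderOf_simple_mul_comm]; omega)), ← mul_assoc, ← mul_assoc,
    ← altElt_succ, h1, altElt_succ_mul, altElt_succ_mul]
  exact Nat.lt_succ_of_le (length_altElt_le cs j i n)

/-- If the order of `s_i s_j` is odd, then `s_i` and `s_j` are conjugate. -/
lemma even_orderOf_of_wt_ne (p : Weights cs) (h : p.wt i ≠ p.wt j) :
    Even (orderOf (cs.simple i * cs.simple j)) := by
  by_contra ho
  obtain ⟨k, hk⟩ := Nat.not_even_iff_odd.1 ho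
  apply h
  apply p.wt_eq_of_isConj
  rw [isConj_iff]
  refine ⟨altElt cs j i (2 * k), ?_⟩
  have e := altElt_orderOf cs i j
  rw [hk, altElt_succ, altElt_succ_even cs j i (even_two_mul k)] at e
  rw [e, mul_inv_cancel_right]

end DihedralWords

section DihedralKL

/-! ### The Kazhdan-Lusztig basis of dihedral parabolic subgroups -/

variable {B W : Type*} [Group W] {M : CoxeterMatrix B} {cs : CoxeterSystem M W} (p : Weights cs)

open Classical in
/-- The candidate for `C'_w`, where `w` is the alternating product `altElt cs i j n` and `n ≥ 1`;
for `n = 0` this is `0`, by convention. -/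
def dihKL (i j : B) (n : ℕ) : Hecke p :=
  if Even n then dihEven p i j (n / 2) else dihOdd p i j (n / 2)

variable {i j : B}

variable (i j) in
lemma dihKL_even (k : ℕ) : dihKL p i j (2 * k) = dihEven p i j k := by
  rw [dihKL, if_pos (even_two_mul k), Nat.mul_div_cancel_left k two_pos]

variable (i j) in
lemma dihKL_odd (k : ℕ) : dihKL p i j (2 * k + 1) = dihOdd p i j k := by
  rw [dihKL, if_neg (by simp)]
  congr 1
  omega

lemma mul_stdBasis_altElt_even {k : ℕ} (h : InRange cs i j (2 * k + 1)) :
    stdBasis p (cs.simple i) * stdBasis p (altElt cs i j (2 * k)) =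
      stdBasis p (altElt cs i j (2 * k + 1)) := by
  have e := altElt_succ_even cs i j (even_two_mul k)
  rw [stdBasis_mul_of_length_add, ← e]
  rw [← e, length_altElt h, length_altElt (h.mono (by omega)), length_simple, add_comm]

lemma mul_stdBasis_altElt_odd {k : ℕ} (h : InRange cs i j (2 * k + 2)) :
    stdBasis p (cs.simple j) * stdBasis p (altElt cs i j (2 * k + 1)) =
      stdBasis p (altElt cs i j (2 * k + 2)) := by
  have e := altElt_succ_odd cs i j (n := 2 * k + 1) (by simp)
  rw [stdBasis_mul_of_length_add, ← e]
  rw [← e, length_altElt h, length_altElt (h.mono (by omega)), length_simple]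
  omega

lemma dihStd_eq {k : ℕ} (h : InRange cs i j (2 * k)) :
    dihStd p i j k = stdBasis p (altElt cs j i (2 * k)) * klSimple p i := by
  induction k with
  | zero => rw [dihStd, mul_zero, altElt_zero, ← one_def, one_mul]
  | succ k ih =>
    rw [dihStd, ih (h.mono (by omega)), ← mul_assoc (stdBasis p (cs.simple j)),
      mul_stdBasis_altElt_even p (h.symm.mono (by omega)), ← mul_assoc,
      mul_stdBasis_altElt_odd p h.symm, mul_add]

lemma simple_mul_dihStd_eq {k : ℕ} (h : InRange cs i j (2 * k + 1)) :
    stdBasis p (cs.simple j) * dihStd p i j k =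
      stdBasis p (altElt cs j i (2 * k + 1)) * klSimple p i := by
  rw [dihStd_eq p (h.mono (by omega)), ← mul_assoc, mul_stdBasis_altElt_even p h.symm]

lemma stdBasis_altElt_mul_klSimple {n : ℕ} (h : InRange cs i j (n + 1)) {y : W}
    (hy : y ∈ minReps cs {i, j}) :
    stdBasis p y * (stdBasis p (altElt cs j i n) * klSimple p i) =
      stdBasis p (y * altElt cs i j (n + 1)) + 𝐯 (-p.wt i) • stdBasis p (y * altElt cs j i n) := by
  have e : stdBasis p (altElt cs j i n) * stdBasis p (cs.simple i) =
      stdBasis p (altElt cs i j (n + 1)) := by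
    rw [stdBasis_mul_of_length_add, ← altElt_succ]
    rw [← altElt_succ, length_altElt h, length_altElt (h.symm.mono (by omega)), length_simple]
  have hm : altElt cs j i n ∈ parabolic cs {i, j} := by
    rw [Set.pair_comm]; exact altElt_mem_parabolic cs j i n
  rw [klSimple, mul_add, e, mul_smul_comm, mul_one, mul_add, mul_smul_comm,
    stdBasis_mul_of_length_add p (length_mul_of_mem_minReps cs hy (altElt_mem_parabolic cs i j _)),
    stdBasis_mul_of_length_add p (length_mul_of_mem_minReps cs hy hm)]

variable (hpos : ∀ i, 0 < p.wt i)

include hpos in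
lemma stdBasis_altElt_mul_klSimple_sub_mem {n : ℕ} (h : InRange cs i j (n + 1)) {y : W}
    (hy : y ∈ minReps cs {i, j}) :
    stdBasis p y * (stdBasis p (altElt cs j i n) * klSimple p i) -
      stdBasis p (y * altElt cs i j (n + 1)) ∈ degLE p (-1) := by
  have := hpos i
  rw [stdBasis_altElt_mul_klSimple p h hy, add_sub_cancel_left]
  exact T_smul_mem_degLE p (stdBasis_mem_degLE p _) (by omega)

include hpos in
lemma stdBasis_altElt_mul_klSimple_mem {n : ℕ} (h : InRange cs i j (n + 1)) {y : W}
    (hy : y ∈ minReps cs {i, j}) :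
    stdBasis p y * (stdBasis p (altElt cs j i n) * klSimple p i) ∈ degLE p 0 := by
  have := add_mem (degLE_mono p (by omega) (stdBasis_altElt_mul_klSimple_sub_mem p hpos h hy))
    (stdBasis_mem_degLE p (y * altElt cs i j (n + 1)))
  rwa [sub_add_cancel] at this

include hpos in
lemma stdBasis_mul_dihKL_sub_mem {n : ℕ} (hn : n ≠ 0) (h : InRange cs i j n) {y : W}
    (hy : y ∈ minReps cs {i, j}) :
    stdBasis p y * dihKL p i j n - stdBasis p (y * altElt cs i j n) ∈ degLE p (-1) := by
  have hf : ∀ l, 2 * l + 1 ≤ n → stdBasis p y * dihStd p i j l ∈ degLE p 0 := by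
    intro l hl
    rw [dihStd_eq p (h.mono (by omega))]
    exact stdBasis_altElt_mul_klSimple_mem p hpos (h.mono hl) hy
  have hg : ∀ l, 2 * l + 2 ≤ n →
      stdBasis p y * (stdBasis p (cs.simple j) * dihStd p i j l) ∈ degLE p 0 := by
    intro l hl
    rw [simple_mul_dihStd_eq p (h.mono (by omega))]
    exact stdBasis_altElt_mul_klSimple_mem p hpos (h.mono hl) hy
  rcases Nat.even_or_odd' n with ⟨k, rfl | rfl⟩
  · obtain ⟨k, rfl⟩ := Nat.exists_eq_succ_of_ne_zero (n := k) (by omega)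
    have h1 := (mul_dihOddSum_dihEven_mem p hpos (stdBasis p y) (k := k)
      (fun l hl ↦ hf l (by omega)) (fun l hl ↦ hg l (by omega))).2.2
    rw [simple_mul_dihStd_eq p (h.mono (by omega))] at h1
    have h2 := stdBasis_altElt_mul_klSimple_sub_mem p hpos (n := 2 * k + 1) h hy
    rw [dihKL_even]
    have := add_mem h1 h2
    rwa [sub_add_sub_cancel] at this
  · have h1 := mul_dihOdd_sub_mem p hpos (stdBasis p y) (k := k)
      (fun l hl ↦ hf l (by omega)) (fun l hl ↦ hg l (by omega))
    rw [dihStd_eq p (h.mono (by omega))] at h1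
    have h2 := stdBasis_altElt_mul_klSimple_sub_mem p hpos (n := 2 * k) h hy
    rw [dihKL_odd]
    have := add_mem h1 h2
    rwa [sub_add_sub_cancel] at this

variable (i j) in
lemma bar_dihKL (n : ℕ) : bar p (dihKL p i j n) = dihKL p i j n := by
  rw [dihKL]
  split_ifs
  · exact bar_dihEven p i j _
  · exact bar_dihOdd p i j _

include hpos in
lemma isKL_dihKL {n : ℕ} (hn : n ≠ 0) (h : InRange cs i j n) :
    IsKL p (altElt cs i j n) (dihKL p i j n) := by
  refine (isKL_iff p).2 ⟨bar_dihKL p i j n, ?_⟩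
  simpa [← one_def] using stdBasis_mul_dihKL_sub_mem p hpos hn h (one_mem_minReps cs _)

include hpos in
/-- Both expressions for the longest element of a finite dihedral group give the same element of
the Kazhdan-Lusztig basis. -/
lemma dihKL_orderOf {n : ℕ} (hn : n ≠ 0) (h : n = orderOf (cs.simple i * cs.simple j)) :
    dihKL p i j n = dihKL p j i n := by
  have h1 := isKL_dihKL p hpos hn (.inr h.le : InRange cs i j n)
  have h2 := isKL_dihKL p hpos hn
    (.inr (h.le.trans (orderOf_simple_mul_comm cs i j).ge) : InRange cs j i n)
  have e := altElt_orderOf cs i j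
  rw [← h] at e
  rw [← e] at h2
  exact h1.unique p h2

lemma simple_mul_mem_of_klSimple_mul_mem {k : B} {h : Hecke p}
    {L : Submodule ℤ[T;T⁻¹] (Hecke p)} (hL : h ∈ L) (hkL : klSimple p k * h ∈ L) :
    stdBasis p (cs.simple k) * h ∈ L := by
  rw [klSimple_mul] at hkL
  have := sub_mem hkL (Submodule.smul_mem L (𝐯 (-p.wt k)) hL)
  rwa [add_sub_cancel_right] at this

/-! ### Monotonicity of the enhanced right descent set -/

include hpos in
/-- The left ideal that detects a single right descent. -/
lemma isLeftClosed_simple (k : B) : IsLeftClosed p {k} (fun _ : Unit ↦ cs.simple k)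
    (fun _ ↦ klSimple p k) where
  bar_eq _ := bar_klSimple p k
  std_mul_sub_mem _ y hy := by
    have := hpos k
    rw [klSimple, mul_add, mul_smul_comm, mul_one, stdBasis_mul_of_length_add p
      (length_mul_of_mem_minReps cs hy (simple_mem_parabolic cs rfl)), add_sub_cancel_left]
    exact T_smul_mem_degLE p (stdBasis_mem_degLE p _) (by omega)
  simple_mul_mem_span _ i hi := by
    rw [Set.mem_singleton_iff.1 hi, simple_mul_klSimple]
    exact Submodule.smul_mem _ _ (Submodule.subset_span ⟨(), rfl⟩)

variable (cs i j) in
/-- The indices for the elements `u` of the dihedral group generated by the non-commuting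
reflections `s_i` and `s_j` such that `u s_i s_j s_i < u`: the alternating products that end in `i`
and have at least two factors, and, if the order `m` of `s_i s_j` is finite, the one with `m - 1`
factors that ends in `j`. -/
abbrev TripleIndex : Type :=
  {n : ℕ // 2 ≤ n ∧ InRange cs i j n} ⊕ {n : ℕ // n + 2 = orderOf (cs.simple i * cs.simple j)}

variable (cs i j) in
/-- The elements `u` of the dihedral group generated by the non-commuting reflections `s_i` and
`s_j` such that `u s_i s_j s_i < u` (see `exists_eq_tripleElt`, `length_tripleElt_mul_lt`). -/
def tripleElt : TripleIndex cs i j → W :=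
  Sum.elim (fun n ↦ altElt cs i j n.1) (fun n ↦ altElt cs j i (n.1 + 1))

variable (i j) in
/-- The Kazhdan-Lusztig elements for the elements `tripleElt`. -/
def tripleKL : TripleIndex cs i j → Hecke p :=
  Sum.elim (fun n ↦ dihKL p i j n.1) (fun n ↦ dihKL p j i (n.1 + 1))

include hpos in
/-- The left ideal that detects `u s_i s_j s_i < u` if `p_i < p_j`. -/
lemma isLeftClosed_triple (h : p.wt i < p.wt j) :
    IsLeftClosed p {i, j} (tripleElt cs i j) (tripleKL p i j) where
  bar_eq b := by
    rcases b with b | b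
    · exact bar_dihKL p i j _
    · exact bar_dihKL p j i _
  std_mul_sub_mem b y hy := by
    rcases b with ⟨n, h2, hn⟩ | ⟨n, hn⟩
    · exact stdBasis_mul_dihKL_sub_mem p hpos (by omega) hn hy
    · rw [Set.pair_comm] at hy
      exact stdBasis_mul_dihKL_sub_mem p hpos n.succ_ne_zero
        (InRange.symm (.inr (by omega) : InRange cs i j (n + 1))) hy
  simple_mul_mem_span b := by
    have heven := even_orderOf_of_wt_ne p h.ne
    have hb : tripleKL p i j b ∈ Submodule.span ℤ[T;T⁻¹] (Set.range (tripleKL p i j)) :=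
      Submodule.subset_span ⟨b, rfl⟩
    have hmem : ∀ n, 2 ≤ n → InRange cs i j n →
        dihKL p i j n ∈ Submodule.span ℤ[T;T⁻¹] (Set.range (tripleKL p i j)) :=
      fun n h2 hn ↦ Submodule.subset_span ⟨.inl ⟨n, h2, hn⟩, rfl⟩
    have heigen : ∀ k, stdBasis p (cs.simple k) * tripleKL p i j b =
        𝐯 (p.wt k) • tripleKL p i j b →
        stdBasis p (cs.simple k) * tripleKL p i j b ∈
          Submodule.span ℤ[T;T⁻¹] (Set.range (tripleKL p i j)) := by
      intro k e
      rw [e]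
      exact Submodule.smul_mem _ _ hb
    suffices H : stdBasis p (cs.simple i) * tripleKL p i j b ∈
        Submodule.span ℤ[T;T⁻¹] (Set.range (tripleKL p i j)) ∧
        stdBasis p (cs.simple j) * tripleKL p i j b ∈
        Submodule.span ℤ[T;T⁻¹] (Set.range (tripleKL p i j)) by
      rintro k (rfl | rfl)
      · exact H.1
      · exact H.2
    rcases b with ⟨n, h2, hn⟩ | ⟨n, hn⟩
    · rcases Nat.even_or_odd' n with ⟨k, rfl | rfl⟩
      · refine ⟨?_, heigen j ?_⟩
        · by_cases hn' : InRange cs i j (2 * k + 1)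
          · apply simple_mul_mem_of_klSimple_mul_mem p hb
            obtain ⟨k, rfl⟩ := Nat.exists_eq_succ_of_ne_zero (n := k) (by omega)
            have e : klSimple p i * dihKL p i j (2 * (k + 1)) = dihKL p i j (2 * (k + 1) + 1) := by
              rw [dihKL_even, dihKL_odd, dihOdd_succ_of_lt p i j h]
            exact e ▸ hmem _ (by omega) hn'
          · -- the longest element: use its other expression, for which `s_i` is the first factor
            apply heigen
            have e := dihKL_orderOf p hpos (by omega) (eq_orderOf_of_not_inRange_succ hn hn')
            change stdBasis p (cs.simple i) * dihKL p i j (2 * k) =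
              𝐯 (p.wt i) • dihKL p i j (2 * k)
            rw [e, dihKL_even, simple_mul_dihEven]
        · change stdBasis p (cs.simple j) * dihKL p i j (2 * k) = 𝐯 (p.wt j) • dihKL p i j (2 * k)
          rw [dihKL_even, simple_mul_dihEven]
      · refine ⟨heigen i ?_, simple_mul_mem_of_klSimple_mul_mem p hb ?_⟩
        · change stdBasis p (cs.simple i) * dihKL p i j (2 * k + 1) =
            𝐯 (p.wt i) • dihKL p i j (2 * k + 1)
          rw [dihKL_odd, simple_mul_dihOdd]
        · obtain ⟨k, rfl⟩ := Nat.exists_eq_succ_of_ne_zero (n := k) (by omega)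
          have hn' : InRange cs i j (2 * (k + 2)) := by
            obtain ⟨r, hr⟩ := heven
            unfold InRange at *
            omega
          have e : klSimple p j * dihKL p i j (2 * (k + 1) + 1) = dihKL p i j (2 * (k + 2)) +
              zeta p i j • dihKL p i j (2 * (k + 1)) + dihKL p i j (2 * k) := by
            rw [dihKL_even, dihKL_even, dihKL_even, dihKL_odd,
              klSimple_mul_dihOdd_succ_of_lt p i j h]
          change klSimple p j * dihKL p i j (2 * (k + 1) + 1) ∈ _
          rw [e]
          refine add_mem (add_mem (hmem _ (by omega) hn') (Submodule.smul_mem _ _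
            (hmem _ (by omega) (hn'.mono (by omega))))) ?_
          rcases Nat.eq_zero_or_pos k with rfl | hk
          · rw [dihKL_even, dihEven]; exact zero_mem _
          · exact hmem _ (by omega) (hn'.mono (by omega))
    · obtain ⟨k, rfl⟩ : ∃ k, n = 2 * k := by
        obtain ⟨r, hr⟩ := heven
        exact ⟨r - 1, by omega⟩
      refine ⟨simple_mul_mem_of_klSimple_mul_mem p hb ?_, heigen j ?_⟩
      · have e : klSimple p i * dihKL p j i (2 * k + 1) = dihKL p i j (2 * (k + 1)) := by
          rw [dihKL_orderOf p hpos (n := 2 * (k + 1)) (by omega) hn, dihKL_even, dihKL_odd,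
            klSimple_mul_dihOdd_of_gt p j i h]
        exact e ▸ hmem _ (by omega) (.inr hn.le)
      · change stdBasis p (cs.simple j) * dihKL p j i (2 * k + 1) =
          𝐯 (p.wt j) • dihKL p j i (2 * k + 1)
        rw [dihKL_odd, simple_mul_dihOdd]

/-- If `s_i` and `s_j` do not commute, then the order of `s_i s_j` is at least `3`. -/
lemma inRange_three_of_not_commute (h : cs.simple i * cs.simple j ≠ cs.simple j * cs.simple i) :
    InRange cs i j 3 := by
  by_contra hn
  apply h
  have hdvd : orderOf (cs.simple i * cs.simple j) ∣ 2 := by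
    unfold InRange at hn
    have h0 : orderOf (cs.simple i * cs.simple j) ≠ 0 := by omega
    have h3 : orderOf (cs.simple i * cs.simple j) < 3 := by omega
    interval_cases orderOf (cs.simple i * cs.simple j) <;> simp_all
  have e := orderOf_dvd_iff_pow_eq_one.1 hdvd
  rw [pow_two, mul_eq_one_iff_eq_inv, mul_inv_rev, inv_simple, inv_simple] at e
  exact e

lemma length_tripleElt_mul_lt (b : TripleIndex cs i j) :
    cs.length (tripleElt cs i j b * (cs.simple i * cs.simple j * cs.simple i)) <
      cs.length (tripleElt cs i j b) := by
  rcases b with ⟨n, h2, hn⟩ | ⟨n, hn⟩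
  · exact length_altElt_mul_of_two_le h2 hn
  · exact length_altElt_mul_of_eq_orderOf hn

lemma exists_eq_tripleElt (h : cs.simple i * cs.simple j ≠ cs.simple j * cs.simple i) {u : W}
    (hu : u ∈ parabolic cs {i, j})
    (hlt : cs.length (u * (cs.simple i * cs.simple j * cs.simple i)) < cs.length u) :
    ∃ b, u = tripleElt cs i j b := by
  have h3 := inRange_three_of_not_commute h
  have hr := inRange_length hu
  rcases exists_eq_altElt cs i j hu with e | e
  · by_cases h2 : 2 ≤ cs.length u
    · exact ⟨.inl ⟨_, h2, hr⟩, e⟩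
    · exfalso
      have : cs.length u = 0 ∨ cs.length u = 1 := by omega
      rcases this with h0 | h0
      · omega
      · rw [h0] at e
        rw [e] at hlt
        exact not_length_simple_mul_lt (h3.mono (by omega)) hlt
  · by_cases hr2 : InRange cs i j (cs.length u + 2)
    · rw [e] at hlt
      exact absurd hlt (not_length_altElt_mul_lt hr2)
    · by_cases hr1 : InRange cs i j (cs.length u + 1)
      · have hm := eq_orderOf_of_not_inRange_succ hr1 hr2
        have h4 : 3 ≤ cs.length u + 1 := by unfold InRange at h3 hr2; omega
        obtain ⟨n, hn⟩ := Nat.exists_eq_succ_of_ne_zero (n := cs.length u) (by omega)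
        rw [hn] at e hm
        exact ⟨.inr ⟨n, hm⟩, e⟩
      · have hm := eq_orderOf_of_not_inRange_succ hr hr1
        have h4 : 2 ≤ cs.length u := by unfold InRange at h3 hr1; omega
        have e' := altElt_orderOf cs i j
        rw [← hm] at e'
        exact ⟨.inl ⟨_, h4, hr⟩, e.trans e'.symm⟩

lemma isReflection_triple (i j : B) :
    cs.IsReflection (cs.simple i * cs.simple j * cs.simple i) :=
  ⟨cs.simple i, j, by rw [inv_simple]⟩

lemma isRightDescent_iff_exists_minReps (w : W) (k : B) :
    cs.IsRightDescent w k ↔ ∃ y ∈ minReps cs {k}, w = y * cs.simple k := by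
  constructor
  · intro h
    refine ⟨w * cs.simple k, ?_, by simp⟩
    rintro _ rfl
    rwa [isRightDescent_iff_not_isRightDescent_mul] at h
  · rintro ⟨y, hy, rfl⟩
    rw [isRightDescent_iff_not_isRightDescent_mul, simple_mul_simple_cancel_right]
    exact hy k rfl

/-- Since lengths add up in `X_I · W_I`, the condition `w s_i s_j s_i < w` only concerns the
component of `w` in the dihedral group. -/
lemma length_mul_triple_lt_iff (h : cs.simple i * cs.simple j ≠ cs.simple j * cs.simple i)
    (w : W) : cs.length (w * (cs.simple i * cs.simple j * cs.simple i)) < cs.length w ↔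
      ∃ y ∈ minReps cs {i, j}, ∃ b, w = y * tripleElt cs i j b := by
  have hi : cs.simple i ∈ parabolic cs {i, j} := simple_mem_parabolic cs (by simp)
  have hj : cs.simple j ∈ parabolic cs {i, j} := simple_mem_parabolic cs (by simp)
  have ht := mul_mem (mul_mem hi hj) hi
  have key : ∀ y ∈ minReps cs {i, j}, ∀ u ∈ parabolic cs {i, j},
      (cs.length (y * u * (cs.simple i * cs.simple j * cs.simple i)) < cs.length (y * u) ↔
        cs.length (u * (cs.simple i * cs.simple j * cs.simple i)) < cs.length u) := by
    intro y hy u hu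
    rw [mul_assoc y u, length_mul_of_mem_minReps cs hy hu,
      length_mul_of_mem_minReps cs hy (mul_mem hu ht)]
    omega
  constructor
  · intro hlt
    obtain ⟨y, hy, u, hu, rfl⟩ := exists_minReps_mul cs {i, j} w
    rw [key y hy u hu] at hlt
    obtain ⟨b, rfl⟩ := exists_eq_tripleElt h hu hlt
    exact ⟨y, hy, b, rfl⟩
  · rintro ⟨y, hy, b, rfl⟩
    rw [key y hy]
    · exact length_tripleElt_mul_lt b
    · rcases b with b | b
      · exact altElt_mem_parabolic cs i j _
      · rw [Set.pair_comm]; exact altElt_mem_parabolic cs j i _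

include hpos in
/-- The enhanced right descent set can only grow along `←_L`. -/
theorem enhancedRightDescentSet_subset_of_leftArrow {x y : W} (h : LeftArrow p x y) :
    enhancedRightDescentSet p y ⊆ enhancedRightDescentSet p x := by
  rintro t (⟨k, rfl, hk⟩ | ⟨i, j, hij, hlt, rfl, ht⟩)
  · refine .inl ⟨k, rfl, ?_⟩
    rw [bruhatLT_mul_reflection_iff cs (cs.isReflection_simple k)] at hk ⊢
    obtain ⟨z, hz, rfl⟩ := (isRightDescent_iff_exists_minReps y k).1 hk
    obtain ⟨z', hz', -, rfl⟩ := (isLeftClosed_simple p hpos k).leftArrow p hpos hz () h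
    exact (isRightDescent_iff_exists_minReps _ k).2 ⟨z', hz', rfl⟩
  · refine .inr ⟨i, j, hij, hlt, rfl, ?_⟩
    rw [bruhatLT_mul_reflection_iff cs (isReflection_triple i j)] at ht ⊢
    obtain ⟨z, hz, b, rfl⟩ := (length_mul_triple_lt_iff hij y).1 ht
    exact (length_mul_triple_lt_iff hij x).2
      ((isLeftClosed_triple p hpos hlt).leftArrow p hpos hz b h)

include hpos in
theorem enhancedRightDescentSet_subset_of_leftLE {x y : W} (h : LeftLE p x y) :
    enhancedRightDescentSet p y ⊆ enhancedRightDescentSet p x := by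
  induction h using Relation.ReflTransGen.head_induction_on with
  | refl => exact subset_rfl
  | head h _ ih => exact ih.trans (enhancedRightDescentSet_subset_of_leftArrow p hpos h)

include hpos in
theorem enhancedRightDescentSet_eq_of_leftEquiv {x y : W} (h : LeftEquiv p x y) :
    enhancedRightDescentSet p x = enhancedRightDescentSet p y :=
  (enhancedRightDescentSet_subset_of_leftLE p hpos h.2).antisymm
    (enhancedRightDescentSet_subset_of_leftLE p hpos h.1)

end DihedralKL

section DihedralCells

/-! ### Left cells of dihedral groups -/

variable {B W : Type*} [Group W] {M : CoxeterMatrix B} {cs : CoxeterSystem M W} (p : Weights cs)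
variable (hpos : ∀ i, 0 < p.wt i) {i j : B}

variable {p} in
lemma LeftEquiv.symm {x y : W} (h : LeftEquiv p x y) : LeftEquiv p y x := ⟨h.2, h.1⟩

variable {p} in
lemma LeftEquiv.trans {x y z : W} (h : LeftEquiv p x y) (h' : LeftEquiv p y z) :
    LeftEquiv p x z := ⟨h.1.trans h'.1, h'.2.trans h.2⟩

lemma LeftEquiv.refl (x : W) : LeftEquiv p x x := ⟨.refl, .refl⟩

/-- The span of the `C'_z` with `z ≠ x`. -/
def spanNe (x : W) : Submodule ℤ[T;T⁻¹] (Hecke p) := Submodule.span _ (klElt p '' {x}ᶜ)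

include hpos in
lemma leftArrow_of_mul_eq {k : B} {x y : W} {a : ℤ[T;T⁻¹]} {g : Hecke p} (ha : a ≠ 0)
    (hg : g ∈ spanNe p x) (e : klSimple p k * klElt p y = a • klElt p x + g) :
    LeftArrow p x y := by
  rw [spanNe, Finsupp.mem_span_image_iff_linearCombination] at hg
  obtain ⟨f, hf, rfl⟩ := hg
  refine ⟨k, Finsupp.single x a + f, ?_, ?_⟩
  · rw [klElt_simple p (hpos k), e, ← Finsupp.linearCombination_single,
      ← map_add, Finsupp.linearCombination_apply]
  · have : f x = 0 := by
      by_contra h0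
      exact hf (Finsupp.mem_support_iff.2 h0) rfl
    rwa [Finsupp.add_apply, Finsupp.single_eq_same, this, add_zero]

include hpos in
lemma klElt_altElt {n : ℕ} (hn : n ≠ 0) (h : InRange cs i j n) :
    klElt p (altElt cs i j n) = dihKL p i j n :=
  (isKL_dihKL p hpos hn h).klElt_eq

include hpos in
lemma dihKL_mem_spanNe {l n : ℕ} (hln : l ≠ n) (hl : InRange cs i j l) (hn : InRange cs i j n) :
    dihKL p i j l ∈ spanNe p (altElt cs i j n) := by
  rcases Nat.eq_zero_or_pos l with rfl | hl0
  · rw [show (0 : ℕ) = 2 * 0 from rfl, dihKL_even, dihEven]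
    exact zero_mem _
  · refine Submodule.subset_span ⟨altElt cs i j l, ?_, klElt_altElt p hpos hl0.ne' hl⟩
    intro h
    have := congrArg cs.length (Set.mem_singleton_iff.1 h)
    rw [length_altElt hl, length_altElt hn] at this
    exact hln this

include hpos in
lemma leftArrow_altElt {k : B} {n n' : ℕ} {a : ℤ[T;T⁻¹]} {g : Hecke p} (hn : n ≠ 0)
    (hnr : InRange cs i j n) (hn' : n' ≠ 0) (hnr' : InRange cs i j n') (ha : a ≠ 0)
    (hg : g ∈ spanNe p (altElt cs i j n'))
    (e : klSimple p k * dihKL p i j n = a • dihKL p i j n' + g) :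
    LeftArrow p (altElt cs i j n') (altElt cs i j n) := by
  refine leftArrow_of_mul_eq p hpos ha hg (k := k) ?_
  rw [klElt_altElt p hpos hn hnr, klElt_altElt p hpos hn' hnr', e]

/-! The multiplication rules in a uniform notation. -/

lemma exists_klSimple_mul_dihKL_of_eq (h : p.wt i = p.wt j) (n : ℕ) :
    ∃ k, klSimple p k * dihKL p i j (n + 1) = dihKL p i j (n + 2) + dihKL p i j n := by
  rcases Nat.even_or_odd' n with ⟨k, rfl | rfl⟩
  · refine ⟨j, ?_⟩
    rw [dihKL_odd, show 2 * k + 2 = 2 * (k + 1) by ring, dihKL_even, dihKL_even,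
      klSimple_mul_dihOdd_of_eq p i j h]
  · refine ⟨i, ?_⟩
    rw [show 2 * k + 1 + 1 = 2 * (k + 1) by ring, show 2 * k + 1 + 2 = 2 * (k + 1) + 1 by ring,
      dihKL_odd, dihKL_odd, dihKL_even, klSimple_mul_dihEven_of_eq p i j h]

lemma klSimple_mul_dihKL_even_of_lt (h : p.wt i < p.wt j) (k : ℕ) :
    klSimple p i * dihKL p i j (2 * k + 2) = dihKL p i j (2 * k + 3) := by
  rw [show 2 * k + 2 = 2 * (k + 1) by ring, show 2 * k + 3 = 2 * (k + 1) + 1 by ring,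
    dihKL_odd, dihKL_even, dihOdd_succ_of_lt p i j h]

lemma klSimple_mul_dihKL_odd_of_lt (h : p.wt i < p.wt j) (k : ℕ) :
    klSimple p j * dihKL p i j (2 * k + 3) = dihKL p i j (2 * k + 4) +
      zeta p i j • dihKL p i j (2 * k + 2) + dihKL p i j (2 * k) := by
  rw [show 2 * k + 2 = 2 * (k + 1) by ring, show 2 * k + 3 = 2 * (k + 1) + 1 by ring,
    show 2 * k + 4 = 2 * (k + 2) by ring, dihKL_odd, dihKL_even, dihKL_even, dihKL_even,
    klSimple_mul_dihOdd_succ_of_lt p i j h]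

lemma klSimple_mul_dihKL_odd_of_gt (h : p.wt j < p.wt i) (k : ℕ) :
    klSimple p j * dihKL p i j (2 * k + 1) = dihKL p i j (2 * k + 2) := by
  rw [show 2 * k + 2 = 2 * (k + 1) by ring, dihKL_odd, dihKL_even,
    klSimple_mul_dihOdd_of_gt p i j h]

lemma klSimple_mul_dihKL_two_of_gt (h : p.wt j < p.wt i) :
    klSimple p i * dihKL p i j 2 = dihKL p i j 3 + zeta p i j • dihKL p i j 1 := by
  rw [show 2 = 2 * 1 from rfl, show 3 = 2 * 1 + 1 from rfl, show dihKL p i j 1 =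
    dihKL p i j (2 * 0 + 1) from rfl, dihKL_odd, dihKL_odd, dihKL_even,
    klSimple_mul_dihEven_one_of_gt p i j h]

lemma klSimple_mul_dihKL_even_of_gt (h : p.wt j < p.wt i) (k : ℕ) :
    klSimple p i * dihKL p i j (2 * k + 4) = dihKL p i j (2 * k + 5) +
      zeta p i j • dihKL p i j (2 * k + 3) + dihKL p i j (2 * k + 1) := by
  rw [show 2 * k + 5 = 2 * (k + 2) + 1 by ring, show 2 * k + 3 = 2 * (k + 1) + 1 by ring,
    show 2 * k + 4 = 2 * (k + 2) by ring, dihKL_odd, dihKL_odd, dihKL_odd, dihKL_even,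
    klSimple_mul_dihEven_succ_of_gt p i j h]

include hpos in
/-- Lengthening an alternating product from the left by one factor. -/
lemma leftArrow_altElt_succ {n : ℕ} (hn : n ≠ 0) (h : InRange cs i j (n + 1)) :
    LeftArrow p (altElt cs i j (n + 1)) (altElt cs i j n) := by
  have hr : ∀ l, l ≤ n + 1 → InRange cs i j l := fun l hl ↦ h.mono hl
  have hmem : ∀ l, l ≤ n → dihKL p i j l ∈ spanNe p (altElt cs i j (n + 1)) :=
    fun l hl ↦ dihKL_mem_spanNe p hpos (by omega) (hr l (by omega)) h
  suffices H : ∃ k, ∃ g ∈ spanNe p (altElt cs i j (n + 1)),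
      klSimple p k * dihKL p i j n = (1 : ℤ[T;T⁻¹]) • dihKL p i j (n + 1) + g by
    obtain ⟨k, g, hg, e⟩ := H
    exact leftArrow_altElt p hpos hn (hr n (by omega)) n.succ_ne_zero h one_ne_zero hg e
  simp only [one_smul]
  rcases lt_trichotomy (p.wt i) (p.wt j) with hw | hw | hw
  · rcases Nat.even_or_odd' n with ⟨k, rfl | rfl⟩
    · obtain ⟨k, rfl⟩ := Nat.exists_eq_succ_of_ne_zero (n := k) (by omega)
      exact ⟨i, 0, zero_mem _, by rw [add_zero]; exact klSimple_mul_dihKL_even_of_lt p hw k⟩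
    · rcases k with _ | k
      · refine ⟨j, 0, zero_mem _, ?_⟩
        rw [add_zero, dihKL_odd, klSimple_mul_dihOdd_zero_of_lt]
        exact (dihKL_even p i j 1).symm
      · exact ⟨j, _, add_mem (Submodule.smul_mem _ (zeta p i j) (hmem (2 * k + 2) (by omega)))
          (hmem (2 * k) (by omega)),
          (klSimple_mul_dihKL_odd_of_lt p hw k).trans (add_assoc _ _ _)⟩
  · obtain ⟨n, rfl⟩ := Nat.exists_eq_succ_of_ne_zero hn
    obtain ⟨k, hk⟩ := exists_klSimple_mul_dihKL_of_eq p hw n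
    exact ⟨k, _, hmem n (by omega), hk⟩
  · rcases Nat.even_or_odd' n with ⟨k, rfl | rfl⟩
    · rcases k with _ | _ | k
      · omega
      · exact ⟨i, _, Submodule.smul_mem _ (zeta p i j) (hmem 1 (by omega)),
          klSimple_mul_dihKL_two_of_gt p hw⟩
      · exact ⟨i, _, add_mem (Submodule.smul_mem _ (zeta p i j) (hmem (2 * k + 3) (by omega)))
          (hmem (2 * k + 1) (by omega)),
          (klSimple_mul_dihKL_even_of_gt p hw k).trans (add_assoc _ _ _)⟩
    · exact ⟨j, 0, zero_mem _, by rw [add_zero]; exact klSimple_mul_dihKL_odd_of_gt p hw k⟩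

include hpos in
/-- For equal weights, the alternating products ending in `i`, except for the longest element,
are connected. -/
lemma leftEquiv_altElt_succ_of_eq (hw : p.wt i = p.wt j) {n : ℕ} (hn : n ≠ 0)
    (h : InRange cs i j (n + 2)) :
    LeftEquiv p (altElt cs i j (n + 1)) (altElt cs i j n) := by
  refine ⟨.single (leftArrow_altElt_succ p hpos hn (h.mono (by omega))), .single ?_⟩
  obtain ⟨k, hk⟩ := exists_klSimple_mul_dihKL_of_eq p hw n
  refine leftArrow_altElt p hpos n.succ_ne_zero (h.mono (by omega)) hn (h.mono (by omega))
    (one_ne_zero (α := ℤ[T;T⁻¹])) (dihKL_mem_spanNe p hpos (by omega) h (h.mono (by omega)))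
    (k := k) (hk.trans ?_)
  rw [one_smul, add_comm]

include hpos in
/-- If `p_i < p_j`, the simple reflection `s_i` is cut off from the other alternating products
ending in `i`. -/
lemma leftEquiv_altElt_succ_of_lt (hw : p.wt i < p.wt j) {n : ℕ} (hn : 2 ≤ n)
    (h : InRange cs i j (n + 2)) :
    LeftEquiv p (altElt cs i j (n + 1)) (altElt cs i j n) := by
  have up : ∀ m, m ≠ 0 → m ≤ n + 1 → LeftLE p (altElt cs i j (m + 1)) (altElt cs i j m) :=
    fun m hm hmn ↦ .single (leftArrow_altElt_succ p hpos hm (h.mono (by omega)))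
  refine ⟨up n (by omega) (by omega), ?_⟩
  have heven := even_orderOf_of_wt_ne p hw.ne
  rcases Nat.even_or_odd' n with ⟨k, rfl | rfl⟩
  · obtain ⟨k, rfl⟩ := Nat.exists_eq_succ_of_ne_zero (n := k) (by omega)
    refine .single (leftArrow_altElt p hpos (by omega) (h.mono (by omega)) (by omega)
      (h.mono (by omega)) (zeta_ne_zero p i j) (add_mem
        (dihKL_mem_spanNe p hpos (l := 2 * k + 4) (by omega) h (h.mono (by omega)))
        (dihKL_mem_spanNe p hpos (l := 2 * k) (by omega) (h.mono (by omega)) (h.mono (by omega))))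
      (k := j) ((klSimple_mul_dihKL_odd_of_lt p hw k).trans ?_))
    rw [show 2 * (k + 1) = 2 * k + 2 by ring]
    abel
  · -- here the length can only be lowered by three, after raising it by one
    obtain ⟨k, rfl⟩ := Nat.exists_eq_succ_of_ne_zero (n := k) (by omega)
    have h' : InRange cs i j (2 * k + 6) := by
      obtain ⟨r, hr⟩ := heven
      unfold InRange at *
      omega
    have h1 : LeftLE p (altElt cs i j (2 * k + 2)) (altElt cs i j (2 * k + 5)) := by
      refine .single (leftArrow_altElt p hpos (by omega) (h'.mono (by omega)) (by omega)
        (h'.mono (by omega)) (one_ne_zero (α := ℤ[T;T⁻¹])) (add_mem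
          (dihKL_mem_spanNe p hpos (l := 2 * k + 6) (by omega) h' (h'.mono (by omega)))
          (Submodule.smul_mem _ (zeta p i j) (dihKL_mem_spanNe p hpos (l := 2 * k + 4) (by omega)
            (h'.mono (by omega)) (h'.mono (by omega)))))
        (k := j) ((klSimple_mul_dihKL_odd_of_lt p hw (k + 1)).trans ?_))
      rw [one_smul, add_comm]
      rfl
    exact ((up (2 * k + 2) (by omega) (by omega)).trans h1).trans (up (2 * k + 4) (by omega)
      (by omega))

include hpos in
/-- If `p_j < p_i`, the alternating product with one factor less than the longest element is cut off
from the shorter ones ending in `i`. -/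
lemma leftEquiv_altElt_succ_of_gt (hw : p.wt j < p.wt i) {n : ℕ} (hn : n ≠ 0)
    (h : InRange cs i j (n + 3)) :
    LeftEquiv p (altElt cs i j (n + 1)) (altElt cs i j n) := by
  have up : ∀ m, m ≠ 0 → m ≤ n + 1 → LeftLE p (altElt cs i j (m + 1)) (altElt cs i j m) :=
    fun m hm hmn ↦ .single (leftArrow_altElt_succ p hpos hm (h.mono (by omega)))
  refine ⟨up n (by omega) (by omega), ?_⟩
  rcases Nat.even_or_odd' n with ⟨k, rfl | rfl⟩
  · -- here the length can only be lowered by three, after raising it by one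
    obtain ⟨k, rfl⟩ := Nat.exists_eq_succ_of_ne_zero (n := k) (by omega)
    have h1 : LeftLE p (altElt cs i j (2 * k + 1)) (altElt cs i j (2 * k + 4)) := by
      refine .single (leftArrow_altElt p hpos (by omega) (h.mono (by omega)) (by omega)
        (h.mono (by omega)) (one_ne_zero (α := ℤ[T;T⁻¹])) (add_mem
          (dihKL_mem_spanNe p hpos (l := 2 * k + 5) (by omega) h (h.mono (by omega)))
          (Submodule.smul_mem _ (zeta p i j) (dihKL_mem_spanNe p hpos (l := 2 * k + 3) (by omega)
            (h.mono (by omega)) (h.mono (by omega)))))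
        (k := i) ((klSimple_mul_dihKL_even_of_gt p hw k).trans ?_))
      rw [one_smul, add_comm]
    exact ((up (2 * k + 1) (by omega) (by omega)).trans h1).trans (up (2 * k + 3) (by omega)
      (by omega))
  · rcases k with _ | k
    · refine .single (leftArrow_altElt p hpos (by omega) (h.mono (by omega)) (by omega)
        (h.mono (by omega)) (zeta_ne_zero p i j)
        (dihKL_mem_spanNe p hpos (l := 3) (by omega) (h.mono (by omega)) (h.mono (by omega)))
        (k := i) ((klSimple_mul_dihKL_two_of_gt p hw).trans (add_comm _ _)))
    · refine .single (leftArrow_altElt p hpos (by omega) (h.mono (by omega)) (by omega)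
        (h.mono (by omega)) (zeta_ne_zero p i j) (add_mem
          (dihKL_mem_spanNe p hpos (l := 2 * k + 5) (by omega) (h.mono (by omega))
            (h.mono (by omega)))
          (dihKL_mem_spanNe p hpos (l := 2 * k + 1) (by omega) (h.mono (by omega))
            (h.mono (by omega))))
        (k := i) ((klSimple_mul_dihKL_even_of_gt p hw k).trans ?_))
      rw [show 2 * (k + 1) + 1 = 2 * k + 3 by ring]
      abel

lemma leftEquiv_of_succ {w : ℕ → W} {a d : ℕ}
    (h : ∀ n, a ≤ n → InRange cs i j (n + 1 + d) → LeftEquiv p (w (n + 1)) (w n)) {m n : ℕ}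
    (hm : a ≤ m) (hn : a ≤ n) (hmr : InRange cs i j (m + d)) (hnr : InRange cs i j (n + d)) :
    LeftEquiv p (w m) (w n) := by
  have key : ∀ n, a ≤ n → InRange cs i j (n + d) → LeftEquiv p (w n) (w a) := by
    intro n hn
    induction n, hn using Nat.le_induction with
    | base => exact fun _ ↦ LeftEquiv.refl p _
    | succ n hn ih => exact fun hr ↦ (h n hn hr).trans (ih (hr.mono (by omega)))
  exact (key m hm hmr).trans (key n hn hnr).symm

/-! The enhanced right descent set determines the left cell. -/

lemma simple_ne_triple (h : cs.simple i * cs.simple j ≠ cs.simple j * cs.simple i) {k : B}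
    (hk : k = i ∨ k = j) : cs.simple k ≠ cs.simple i * cs.simple j * cs.simple i := by
  rintro e
  apply h
  rcases hk with rfl | rfl
  · have : cs.simple k * cs.simple j = 1 := by simpa using e.symm
    rw [this, mul_eq_one_iff_eq_inv.1 this]; simp
  · have := congrArg (· * cs.simple i) e
    simpa using this.symm

lemma simple_mem_enhanced_iff (hB : ∀ k, k = i ∨ k = j) {w : W} {k : B} :
    cs.simple k ∈ enhancedRightDescentSet p w ↔ cs.IsRightDescent w k := by
  rw [CoxeterSystem.IsRightDescent, ← bruhatLT_mul_reflection_iff cs (cs.isReflection_simple k)]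
  constructor
  · rintro (⟨l, e, h⟩ | ⟨a, b, hab, -, e, -⟩)
    · rwa [e]
    · have hne : a ≠ b := by rintro rfl; exact hab rfl
      refine absurd e (simple_ne_triple hab ?_)
      rcases hB a with ha | ha <;> rcases hB b with hb | hb
      · exact absurd (ha.trans hb.symm) hne
      · rw [ha, hb]; exact hB k
      · rw [ha, hb]; exact (hB k).symm
      · exact absurd (ha.trans hb.symm) hne
  · exact fun h ↦ .inl ⟨k, rfl, h⟩

lemma triple_mem_enhanced_iff (hB : ∀ k, k = i ∨ k = j)
    (hc : cs.simple i * cs.simple j ≠ cs.simple j * cs.simple i) (hw : p.wt i < p.wt j) {w : W} :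
    cs.simple i * cs.simple j * cs.simple i ∈ enhancedRightDescentSet p w ↔
      cs.length (w * (cs.simple i * cs.simple j * cs.simple i)) < cs.length w := by
  rw [← bruhatLT_mul_reflection_iff cs (isReflection_triple i j)]
  constructor
  · rintro (⟨k, e, -⟩ | ⟨a, b, -, -, e, h⟩)
    · exact absurd e.symm (simple_ne_triple hc (hB k))
    · rwa [e]
  · exact fun h ↦ .inr ⟨i, j, hc, hw, rfl, h⟩

lemma not_inRange_three_of_commute (hij : cs.simple i * cs.simple j = cs.simple j * cs.simple i) :
    ¬ InRange cs i j 3 := by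
  have h : (cs.simple i * cs.simple j) ^ 2 = 1 := by
    rw [pow_two]
    nth_rewrite 2 [hij]
    simp [mul_assoc]
  have := Nat.le_of_dvd two_pos (orderOf_dvd_of_pow_eq_one h)
  have h0 := orderOf_pos_iff.2 (isOfFinOrder_iff_pow_eq_one.2 ⟨2, two_pos, h⟩)
  unfold InRange
  omega

include hpos in
/-- The triple product in `ℛ^π` recognizes the alternating products that are cut off from the others
ending in `i`. -/
lemma leftEquiv_altElt_of_enhanced_eq (hB : ∀ k, k = i ∨ k = j) {n l : ℕ} (hn : n ≠ 0)
    (hl : l ≠ 0) (hnr : InRange cs i j (n + 1)) (hlr : InRange cs i j (l + 1))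
    (h : enhancedRightDescentSet p (altElt cs i j n) =
      enhancedRightDescentSet p (altElt cs i j l)) :
    LeftEquiv p (altElt cs i j n) (altElt cs i j l) := by
  by_cases hc : cs.simple i * cs.simple j = cs.simple j * cs.simple i
  · have h3 := not_inRange_three_of_commute hc
    have hn1 : n = 1 := by
      by_contra hn1
      exact h3 (hnr.mono (by omega))
    have hl1 : l = 1 := by
      by_contra hl1
      exact h3 (hlr.mono (by omega))
    rw [hn1, hl1]
    exact LeftEquiv.refl p _
  have h3 := inRange_three_of_not_commute hc
  rcases lt_trichotomy (p.wt i) (p.wt j) with hw | hw | hw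
  · have key : ∀ n, n ≠ 0 → InRange cs i j (n + 1) →
        (cs.simple i * cs.simple j * cs.simple i ∈
          enhancedRightDescentSet p (altElt cs i j n) ↔ 2 ≤ n) := by
      intro n hn hnr
      rw [triple_mem_enhanced_iff p hB hc hw]
      by_cases h2 : 2 ≤ n
      · exact iff_of_true (length_altElt_mul_of_two_le h2 (hnr.mono (by omega))) h2
      · obtain rfl : n = 1 := by omega
        exact iff_of_false (not_length_simple_mul_lt (h3.mono (by omega))) h2
    have e := key n hn hnr
    rw [h, key l hl hlr] at e
    by_cases h2 : 2 ≤ n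
    · exact leftEquiv_of_succ p (i := i) (j := j) (w := altElt cs i j) (d := 1)
        (fun m hm hr ↦ leftEquiv_altElt_succ_of_lt p hpos hw hm hr) h2 (e.2 h2) hnr hlr
    · obtain rfl : n = 1 := by omega
      obtain rfl : l = 1 := by omega
      exact LeftEquiv.refl p _
  · exact leftEquiv_of_succ p (i := i) (j := j) (w := altElt cs i j) (d := 1) (a := 1)
      (fun m hm hr ↦ leftEquiv_altElt_succ_of_eq p hpos hw (by omega) hr) (by omega) (by omega)
      hnr hlr
  · have key : ∀ n, n ≠ 0 → InRange cs i j (n + 1) →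
        (cs.simple j * cs.simple i * cs.simple j ∈
          enhancedRightDescentSet p (altElt cs i j n) ↔ ¬ InRange cs i j (n + 2)) := by
      intro n hn hnr
      rw [triple_mem_enhanced_iff p (fun k ↦ (hB k).symm) (Ne.symm hc) hw]
      by_cases h2 : InRange cs i j (n + 2)
      · exact iff_of_false (not_length_altElt_mul_lt h2.symm) (not_not.2 h2)
      · have hm := eq_orderOf_of_not_inRange_succ hnr h2
        obtain ⟨n, rfl⟩ := Nat.exists_eq_succ_of_ne_zero hn
        rw [orderOf_simple_mul_comm] at hm
        exact iff_of_true (length_altElt_mul_of_eq_orderOf hm) h2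
    have e := key n hn hnr
    rw [h, key l hl hlr, not_iff_not] at e
    by_cases h2 : InRange cs i j (n + 2)
    · exact leftEquiv_of_succ p (i := i) (j := j) (w := altElt cs i j) (d := 2) (a := 1)
        (fun m hm hr ↦ leftEquiv_altElt_succ_of_gt p hpos hw (by omega) hr) (by omega) (by omega)
        h2 (e.2 h2)
    · have h4 := eq_orderOf_of_not_inRange_succ hnr h2
      have h5 := eq_orderOf_of_not_inRange_succ hlr (fun h ↦ h2 (e.1 h))
      obtain rfl : n = l := by omega
      exact LeftEquiv.refl p _

lemma parabolic_eq_top (hB : ∀ k, k = i ∨ k = j) (w : W) : w ∈ parabolic cs {i, j} := by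
  obtain ⟨ω, rfl⟩ := cs.wordProd_surjective w
  exact wordProd_mem_parabolic cs fun k _ ↦ by simpa using hB k

include hpos in
theorem leftEquiv_of_enhanced_eq (hB : ∀ k, k = i ∨ k = j) {x y : W}
    (h : enhancedRightDescentSet p x = enhancedRightDescentSet p y) : LeftEquiv p x y := by
  have hdesc : ∀ k, cs.IsRightDescent x k ↔ cs.IsRightDescent y k := by
    intro k
    rw [← simple_mem_enhanced_iff p hB, h, simple_mem_enhanced_iff p hB]
  have main : ∀ a b : B, (∀ k, k = a ∨ k = b) → x = altElt cs a b (cs.length x) →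
      LeftEquiv p x y := by
    intro a b hab ex
    have hxr := inRange_length (parabolic_eq_top (cs := cs) hab x)
    have hyr := inRange_length (parabolic_eq_top (cs := cs) hab y)
    have ey := exists_eq_altElt cs a b (parabolic_eq_top hab y)
    by_cases hx0 : cs.length x = 0
    · obtain rfl := cs.length_eq_zero_iff.1 hx0
      have : y = 1 := by
        by_contra hy
        obtain ⟨k, hk⟩ := cs.exists_rightDescent_of_ne_one hy
        exact cs.not_isRightDescent_one k ((hdesc k).2 hk)
      rw [this]
      exact LeftEquiv.refl p _
    have hy0 : cs.length y ≠ 0 := by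
      intro hy0
      obtain rfl := cs.length_eq_zero_iff.1 hy0
      obtain ⟨k, hk⟩ := cs.exists_rightDescent_of_ne_one
        (w := x) (fun h ↦ hx0 (by rw [h, length_one]))
      exact cs.not_isRightDescent_one k ((hdesc k).1 hk)
    -- an alternating product ending in `c` has `c` as a descent, and the other reflection only if
    -- it is the longest element
    have hlast : ∀ c d (u : W), cs.length u ≠ 0 → InRange cs c d (cs.length u) →
        u = altElt cs c d (cs.length u) → cs.IsRightDescent u c := by
      intro c d u hu hr e
      obtain ⟨n, hn⟩ := Nat.exists_eq_succ_of_ne_zero hu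
      rw [hn] at e hr
      rw [e]
      exact isRightDescent_altElt_succ hr
    have hlong : ∀ c d (u : W), InRange cs c d (cs.length u) →
        u = altElt cs c d (cs.length u) → cs.IsRightDescent u d →
        ¬ InRange cs c d (cs.length u + 1) := by
      intro c d u hr e hd hn
      rw [e] at hd
      exact not_isRightDescent_altElt hn hd
    have hxa := hlast a b x hx0 hxr ex
    have hya := (hdesc a).1 hxa
    by_cases hxr1 : InRange cs a b (cs.length x + 1)
    · have hxb : ¬ cs.IsRightDescent x b := fun hb ↦ hlong a b x hxr ex hb hxr1
      rcases ey with ey | ey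
      · have hyr1 : InRange cs a b (cs.length y + 1) := by
          by_contra hyr1
          have hm := eq_orderOf_of_not_inRange_succ hyr hyr1
          have e := altElt_orderOf cs a b
          rw [← hm, ← ey] at e
          exact hxb ((hdesc b).2 (hlast b a y hy0 hyr.symm e))
        rw [ex, ey] at h ⊢
        exact leftEquiv_altElt_of_enhanced_eq p hpos hab hx0 hy0 hxr1 hyr1 h
      · exact absurd ((hdesc b).2 (hlast b a y hy0 hyr.symm ey)) hxb
    · have hm := eq_orderOf_of_not_inRange_succ hxr hxr1
      have e := altElt_orderOf cs a b
      rw [← hm, ← ex] at e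
      have hxb := hlast b a x hx0 hxr.symm e
      have hyb := (hdesc b).1 hxb
      have hlen : cs.length y = cs.length x := by
        rcases ey with ey | ey
        · rw [hm]
          exact eq_orderOf_of_not_inRange_succ hyr (hlong a b y hyr ey hyb)
        · rw [hm, ← orderOf_simple_mul_comm]
          exact eq_orderOf_of_not_inRange_succ hyr.symm (hlong b a y hyr.symm ey hya)
      have : x = y := by
        rcases ey with ey | ey
        · rw [ey, hlen, ← ex]
        · rw [ey, hlen, ← e]
      rw [this]
      exact LeftEquiv.refl p _
  rcases exists_eq_altElt cs i j (parabolic_eq_top hB x) with e | e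
  · exact main i j hB e
  · exact main j i (fun k ↦ (hB k).symm) e

end DihedralCells

end KLCell

end

theorem corollary2p6 {B W : Type*} [Group W] {M : CoxeterMatrix B} (cs : CoxeterSystem M W)
    (p : KLCell.Weights cs) (hpos : ∀ i, 0 < p.wt i) :
    (∀ x y : W, KLCell.LeftEquiv p x y →
      KLCell.enhancedRightDescentSet p x = KLCell.enhancedRightDescentSet p y) ∧
    ((∃ i j : B, i ≠ j ∧ ∀ k, k = i ∨ k = j) →
      ∀ x y : W, KLCell.LeftEquiv p x y ↔
        KLCell.enhancedRightDescentSet p x = KLCell.enhancedRightDescentSet p y) := by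
  refine ⟨fun x y ↦ KLCell.enhancedRightDescentSet_eq_of_leftEquiv p hpos, ?_⟩
  rintro ⟨i, j, -, hB⟩ x y
  exact ⟨KLCell.enhancedRightDescentSet_eq_of_leftEquiv p hpos,
    KLCell.leftEquiv_of_enhanced_eq p hpos hB⟩
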